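/- Let $(\mathbb X,\mathcal X)$ be a measurable space with a $\sigma$-finite measure $\Lambda$, and let $\mathbf N$ be the space of all $\sigma$-finite measures on $\mathbb X$ with values in $\{0,1,2,\ldots,\infty\}$, equipped with the smallest $\sigma$-field making all maps $\mu\mapsto\mu(B)$, $B\in\mathcal X$, measurable. For a $\sigma$-finite measure $\Lambda'$ on $\mathbb X$ let $\Pi_{\Lambda'}$ denote the distribution on $\mathbf N$ of a Poisson process with intensity measure $\Lambda'$. Let $\eta$ be a Poisson process on $\mathbb X$ with intensity measure $\Lambda$, defined on a probability space $(\Omega,\mathcal A,\mathbb P)$, and suppose that $\eta$ is proper: almost surely $\eta=\sum_{n=1}^{\kappa}\delta_{X_n}$, with random elements $X_1,X_2,\ldots$ of $\mathbb X$ and a random variable $\kappa$ with values in $\{0,1,2,\ldots,\infty\}$. For $t\in[0,1]$ let $\eta_t:=\sum_{n=1}^{\kappa}Y^{(t)}_n\delta_{X_n}$ be a $t$-thinning of $\eta$, where $Y^{(t)}_1,Y^{(t)}_2,\ldots$ are independent with distribution $(1-t)\delta_0+t\delta_1$, the sequence $(Y_n^{(t)})_{n\ge 1}$ is independent of $(\kappa,X_1,X_2,\ldots)$,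 and $(t,\omega)\mapsto Y^{(t)}_n(\omega)$ is measurable for each $n$. Put $D_xf(\mu):=f(\mu+\delta_x)-f(\mu)$ for $f\colon\mathbf N\to\mathbb R$. Let $f\colon\mathbf N\to\mathbb R$ be measurable, let $F=f(\eta)$ almost surely, with $F\in L^2(\mathbb P)$, and write $D_xF:=D_xf(\eta)$ and $D_xe^{sF}:=D_x(e^{sf})(\eta)$. Define $$s_F:=\sup\big\{s\ge 0: e^{sF}\in L^2(\mathbb P),\ De^{sF}\in L^2(\mathbb P\otimes\Lambda)\big\}\in[0,\infty],$$ $$V_F(s):=\int_{\mathbb X}\big(e^{sD_xF}-1\big)\int_0^1\int_{\mathbf N}D_xf(\eta_t+\mu)\,\Pi_{(1-t)\Lambda}(d\mu)\,dt\,\Lambda(dx),\qquad 0\le s<s_F.$$ Assume that $e^{uF}\in L^2(\mathbb P)$ and $De^{uF}\in L^2(\mathbb P\otimes\Lambda)$ for every $u\in[0,s_F)$ (that is, every $u\in[0,s_F)$ belongs to the set whose supremum defines $s_F$; this is automatic if $DF\in L^2(\mathbb P\otimes\Lambda)$). Let $v\colon[0,s_F)\to\mathbb R$ be a (deterministic)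 measurable function such that, for each $s\in[0,s_F)$, $V_F(s)\le v(s)$ almost surely. Then, for all $r\ge 0$, $$\mathbb P(F-\mathbb E[F]\ge r)\le\exp\Big(\inf_{0<s<s_F}\Big(\int_0^s v(u)\,du-sr\Big)\Big),$$ where the integrals may take the value $+\infty$, $\inf\emptyset:=+\infty$, $\exp(+\infty):=+\infty$ and $\exp(-\infty):=0$. -/

import Mathlib

open MeasureTheory ProbabilityTheory
open scoped ENNReal

noncomputable section

/-- `m` is a σ-finite measure all of whose values lie in `{0, 1, 2, …, ∞}`. -/
def IsPointMeasure {X : Type*} [MeasurableSpace X] (m : Measure X) : Prop :=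
  SigmaFinite m ∧ ∀ B : Set X, MeasurableSet B → ∃ k : ℕ∞, m B = (k : ℝ≥0∞)

/-- The space `𝐍(X)` of σ-finite measures with values in `{0, 1, 2, …, ∞}`. -/
def PointMeasure (X : Type*) [MeasurableSpace X] : Type _ :=
  {m : Measure X // IsPointMeasure m}

namespace PointMeasure

variable {X : Type*} [MeasurableSpace X]

/-- The σ-field on `𝐍(X)`: Mathlib's σ-field on measures is the smallest one that makes all
evaluations `m ↦ m B`, `B` measurable, measurable; this is its trace on `𝐍(X)`. -/
instance : MeasurableSpace (PointMeasure X) :=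
  inferInstanceAs (MeasurableSpace {m : Measure X // IsPointMeasure m})

theorem isPointMeasure_zero : IsPointMeasure (0 : Measure X) :=
  ⟨inferInstance, fun _ _ => ⟨0, by simp⟩⟩

theorem isPointMeasure_add {m m' : Measure X} (h : IsPointMeasure m) (h' : IsPointMeasure m') :
    IsPointMeasure (m + m') := by
  refine ⟨?_, fun B hB => ?_⟩
  · have := h.1
    have := h'.1
    infer_instance
  · obtain ⟨k, hk⟩ := h.2 B hB
    obtain ⟨k', hk'⟩ := h'.2 B hB
    exact ⟨k + k', by simp [hk, hk']⟩

theorem isPointMeasure_dirac (x : X) : IsPointMeasure (Measure.dirac x) := by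
  classical
  refine ⟨inferInstance, fun B hB => ?_⟩
  by_cases hx : x ∈ B
  · exact ⟨1, by simp [Measure.dirac_apply' x hB, hx]⟩
  · exact ⟨0, by simp [Measure.dirac_apply' x hB, hx]⟩

/-- The underlying measure. -/
def toMeasure (μ : PointMeasure X) : Measure X := μ.1

instance : Zero (PointMeasure X) := ⟨⟨0, isPointMeasure_zero⟩⟩

instance : Add (PointMeasure X) := ⟨fun μ ν => ⟨μ.1 + ν.1, isPointMeasure_add μ.2 ν.2⟩⟩

/-- The unit point mass `δ_x`. -/
def dirac (x : X) : PointMeasure X := ⟨Measure.dirac x, isPointMeasure_dirac x⟩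

open scoped Classical in
/-- A measure seen as an element of `𝐍(X)`; measures outside `𝐍(X)` are sent to `0`. -/
def ofMeasure (m : Measure X) : PointMeasure X :=
  if h : IsPointMeasure m then ⟨m, h⟩ else 0

end PointMeasure

section Poisson

variable {X Ω : Type*} [MeasurableSpace X] [MeasurableSpace Ω]

open scoped Classical in
/-- The Poisson distribution on `[0, ∞]` with mean `a ∈ [0, ∞]`; it is `δ_∞` for `a = ∞`. -/
def extPoisson (a : ℝ≥0∞) : Measure ℝ≥0∞ :=
  if a = ∞ then Measure.dirac ∞
  else (poissonMeasure a.toNNReal).map (fun k : ℕ => (k : ℝ≥0∞))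

/-- `η` is a Poisson process with intensity measure `Λ`, defined on `(Ω, P)`. -/
structure IsPoissonProcess (P : Measure Ω) (η : Ω → PointMeasure X) (Λ : Measure X) : Prop where
  measurable : Measurable η
  map_eval : ∀ B : Set X, MeasurableSet B →
    P.map (fun ω => (η ω).toMeasure B) = extPoisson (Λ B)
  indep : ∀ (m : ℕ) (B : Fin m → Set X), (∀ i, MeasurableSet (B i)) →
    Pairwise (fun i j => Disjoint (B i) (B j)) →
    iIndepFun (fun (i : Fin m) ω => (η ω).toMeasure (B i)) P

open scoped Classical in
/-- The distribution `Π_Λ` of a Poisson process with intensity measure `Λ`: the probability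
measure on `𝐍(X)` under which the identity is such a process. The defining properties
determine the finite-dimensional distributions, so there is at most one; and there is one for
every σ-finite `Λ`. -/
def poissonLaw (Λ : Measure X) : Measure (PointMeasure X) :=
  if h : ∃ Q : Measure (PointMeasure X),
      IsProbabilityMeasure Q ∧ IsPoissonProcess Q (fun μ => μ) Λ
  then h.choose else 0

/-- `η = ∑_{n < κ} δ_{ξ n}` almost surely, with random elements `ξ n` of `X` and a random
variable `κ` in `{0, 1, 2, …, ∞}`. -/
structure IsProperRepr (P : Measure Ω) (η : Ω → PointMeasure X) (κ : Ω → ℕ∞)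
    (ξ : ℕ → Ω → X) : Prop where
  measurable_card : Measurable κ
  measurable_point : ∀ n, Measurable (ξ n)
  repr : ∀ᵐ ω ∂P, (η ω).toMeasure =
    Measure.sum (fun n : ℕ => open scoped Classical in
      if (n : ℕ∞) < κ ω then Measure.dirac (ξ n ω) else 0)

/-- For each `t ∈ [0, 1]` the marks `Y t 0, Y t 1, …` (`true` for 1, `false` for 0) are
independent with distribution `(1 - t) δ_0 + t δ_1`, and the sequence is independent of the
points `(κ, ξ 0, ξ 1, …)`. The dependence between different `t` is arbitrary but jointly
measurable (for instance `Y t n = 1{U n ≤ t}` with independent uniform `U n`). -/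
structure IsThinningMarks (P : Measure Ω) (κ : Ω → ℕ∞) (ξ : ℕ → Ω → X)
    (Y : ℝ → ℕ → Ω → Bool) : Prop where
  measurable : ∀ n, Measurable (fun p : ℝ × Ω => Y p.1 n p.2)
  prob : ∀ t ∈ Set.Icc (0 : ℝ) 1, ∀ n, P {ω | Y t n ω = true} = ENNReal.ofReal t
  iIndep : ∀ t ∈ Set.Icc (0 : ℝ) 1, iIndepFun (fun n => Y t n) P
  indep : ∀ t ∈ Set.Icc (0 : ℝ) 1,
    IndepFun (fun ω => fun n => Y t n ω) (fun ω => (κ ω, fun n => ξ n ω)) P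

open scoped Classical in
/-- The `t`-thinning `η_t = ∑_{n < κ} Y t n δ_{ξ n}`. (It lies in `𝐍(X)` whenever
`∑_{n < κ} δ_{ξ n}` does, hence almost surely for a proper representation.) -/
def thinning (κ : Ω → ℕ∞) (ξ : ℕ → Ω → X) (Y : ℝ → ℕ → Ω → Bool) (t : ℝ) (ω : Ω) :
    PointMeasure X :=
  PointMeasure.ofMeasure (Measure.sum (fun n : ℕ =>
    if (n : ℕ∞) < κ ω ∧ Y t n ω = true then Measure.dirac (ξ n ω) else 0))

/-- The difference operator `D_x f(μ) = f(μ + δ_x) - f(μ)`. -/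
def diffOp (x : X) (f : PointMeasure X → ℝ) (μ : PointMeasure X) : ℝ :=
  f (μ + PointMeasure.dirac x) - f μ

/-- The set of `s ≥ 0` with `e^{sF} ∈ L²(P)` and `D e^{sF} ∈ L²(P ⊗ Λ)`, where `F = f(η)`. -/
def expDomain (P : Measure Ω) (η : Ω → PointMeasure X) (Λ : Measure X)
    (f : PointMeasure X → ℝ) : Set ℝ :=
  {s | 0 ≤ s ∧ MemLp (fun ω => Real.exp (s * f (η ω))) 2 P ∧
    MemLp (fun p : Ω × X => diffOp p.2 (fun μ => Real.exp (s * f μ)) (η p.1)) 2 (P.prod Λ)}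

/-- `s_F ∈ [0, ∞]`, the supremum of `expDomain` (which contains `0` if `P` is finite). -/
def expBound (P : Measure Ω) (η : Ω → PointMeasure X) (Λ : Measure X)
    (f : PointMeasure X → ℝ) : EReal :=
  ⨆ s ∈ expDomain P η Λ f, (s : EReal)

/-- `V_F(s) = ∫ (e^{s D_x F} - 1) ∫_0^1 ∫ D_x f(η_t + μ) Π_{(1-t)Λ}(dμ) dt Λ(dx)`. -/
def varFunctional (η : Ω → PointMeasure X) (ηt : ℝ → Ω → PointMeasure X) (Λ : Measure X)
    (f : PointMeasure X → ℝ) (s : ℝ) (ω : Ω) : ℝ :=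
  ∫ x, (Real.exp (s * diffOp x f (η ω)) - 1) *
    (∫ t in (0 : ℝ)..1, ∫ μ, diffOp x f (ηt t ω + μ) ∂(poissonLaw (ENNReal.ofReal (1 - t) • Λ))) ∂Λ

end Poisson

/-- `∫_0^s v(u) du` as an extended real number, positive part minus negative part. -/
def extIntegral (v : ℝ → ℝ) (s : ℝ) : EReal :=
  ((∫⁻ u in Set.Ioo 0 s, ENNReal.ofReal (v u) : ℝ≥0∞) : EReal) -
    ((∫⁻ u in Set.Ioo 0 s, ENNReal.ofReal (-v u) : ℝ≥0∞) : EReal)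

end

/-! The core is a covariance identity of Clark–Ocone type. A `t`-thinning and `η` have the joint law
of `(ζ_t, ζ_t + ζ'_{1-t})` with `ζ'` an independent copy, so `∫ D_x f(η_t + μ) Π_{(1-t)Λ}(dμ)` plays
the role of `E[D_x f(η) | η_t]`. Calling this integrand `clark`, one has `Cov(f(η), g(η)) = ∫_0^1 ∫
E[clark f · clark g] dΛ dt` for square-integrable `f(η)` and `g(η)`; conditioning on `η_t` lets `D_x
g(η)` replace `clark g` when `D g(η)` is in `L²` (`integral_clark_mul_diffOp`).

For `g = e^{sf}` one has `D_x e^{sF} = e^{sF} (e^{s D_x F} - 1)`, so the identity reads `Cov(F,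
e^{sF}) = E[e^{sF} V_F(s)] ≤ v(s) E[e^{sF}]`. This is the differential inequality `(log E[e^{sF}] -
s E[F])' ≤ v(s)`; integration from `0` (Herbst) and the Chernoff bound finish the proof.

The identity is computed on exponential functionals `μ ↦ e^{-∫ h dμ}`, where the Laplace functional
makes every term explicit (`integral_clark_mul_expFun`). It extends by bilinearity, then by density
(`exists_expSpan_eLpNorm_lt`) and the contraction `eLpNorm_clark_le_of_mem_expSpan`. Since `D f(η)`
itself need not be in `L²`, the limiting integrand is identified through an `L¹` bound on sets of
finite intensity, which the Mecke formula supplies. Laws are identified throughout by Laplace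
functionals, via `ext_of_submonoid`. -/

open Filter Topology

noncomputable section

/-! ### Finite measures determined by multiplicative classes of functions. -/

section MultiplicativeClass

variable {S : Type*} [mS : MeasurableSpace S]

open BoundedContinuousFunction in
/-- Finite measures that agree on a multiplicative class of `[0, 1]`-valued functions have the
same finite-dimensional image measures under functions of this class. -/
theorem map_eq_of_submonoid {m₁ m₂ : Measure S} [IsFiniteMeasure m₁] [IsFiniteMeasure m₂]
    (M : Submonoid (S → ℝ)) (hmeas : ∀ g ∈ M, Measurable g)
    (hbd : ∀ g ∈ M, ∀ x, g x ∈ Set.Icc (0 : ℝ) 1)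
    (h : ∀ g ∈ M, ∫ x, g x ∂m₁ = ∫ x, g x ∂m₂) (I : Finset M) :
    m₁.map (fun x (g : I) => (⟨(g : M).1 x, hbd _ (g : M).2 x⟩ : Set.Icc (0 : ℝ) 1)) =
      m₂.map (fun x (g : I) => (⟨(g : M).1 x, hbd _ (g : M).2 x⟩ : Set.Icc (0 : ℝ) 1)) := by
  set φ : S → I → Set.Icc (0 : ℝ) 1 := fun x g => ⟨(g : M).1 x, hbd _ (g : M).2 x⟩ with hφ
  have hφm : Measurable φ := by
    refine measurable_pi_lambda _ fun g => ?_
    exact (hmeas _ (g : M).2).subtype_mk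
  have hint : ∀ g ∈ M, ∀ m : Measure S, IsFiniteMeasure m → Integrable g m := by
    intro g hg m _
    refine Integrable.of_bound (hmeas g hg).aestronglyMeasurable 1 (ae_of_all _ fun x => ?_)
    rw [Real.norm_eq_abs, abs_of_nonneg (hbd g hg x).1]
    exact (hbd g hg x).2
  -- A multiplicative class spans the algebra it generates, so equality of integrals extends by
  -- linearity alone.
  have hadj : ∀ g ∈ Algebra.adjoin ℝ (M : Set (S → ℝ)), Integrable g m₁ ∧ Integrable g m₂ ∧
      ∫ x, g x ∂m₁ = ∫ x, g x ∂m₂ := by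
    intro g hg
    rw [← Subalgebra.mem_toSubmodule, Algebra.adjoin_eq_span_of_subset] at hg
    · induction hg using Submodule.span_induction with
      | mem g hg => exact ⟨hint g hg _ inferInstance, hint g hg _ inferInstance, h g hg⟩
      | zero => simp
      | add a b _ _ ha hb =>
        refine ⟨ha.1.add hb.1, ha.2.1.add hb.2.1, ?_⟩
        simp only [Pi.add_apply]
        rw [integral_add ha.1 hb.1, integral_add ha.2.1 hb.2.1, ha.2.2, hb.2.2]
      | smul c a _ ha =>
        refine ⟨ha.1.smul c, ha.2.1.smul c, ?_⟩
        simp only [Pi.smul_apply]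
        rw [integral_smul, integral_smul, ha.2.2]
    · rw [Submonoid.closure_eq]
      exact Submodule.subset_span
  let Φ : ((I → Set.Icc (0 : ℝ) 1) →ᵇ ℝ) →ₐ[ℝ] (S → ℝ) :=
    { toFun := fun p x => p (φ x)
      map_one' := rfl
      map_mul' := fun _ _ => rfl
      map_zero' := rfl
      map_add' := fun _ _ => rfl
      commutes' := fun _ => rfl }
  let A₀ : Subalgebra ℝ ((I → Set.Icc (0 : ℝ) 1) →ᵇ ℝ) := (Algebra.adjoin ℝ (M : Set (S → ℝ))).comap Φ
  let A : StarSubalgebra ℝ ((I → Set.Icc (0 : ℝ) 1) →ᵇ ℝ) :=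
    { A₀ with
      star_mem' := by
        intro a ha
        have : star a = a := by ext; simp
        rwa [this] }
  -- Stone–Weierstrass on the cube: the pulled-back algebra contains the coordinates, which separate
  -- points.
  refine ext_of_forall_mem_subalgebra_integral_eq_of_pseudoEMetric_complete_countable
    (𝕜 := ℝ) (A := A) ?_ ?_
  · intro a b hab
    obtain ⟨g, hg⟩ := Function.ne_iff.1 hab
    let p : (I → Set.Icc (0 : ℝ) 1) →ᵇ ℝ :=
      BoundedContinuousFunction.mkOfCompact ⟨fun a => (a g : ℝ), by fun_prop⟩
    have hp : p ∈ A := by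
      change Φ p ∈ Algebra.adjoin ℝ (M : Set (S → ℝ))
      exact Algebra.subset_adjoin (g : M).2
    refine ⟨fun a => (a g : ℝ), ⟨_, ⟨p, hp, rfl⟩, rfl⟩, ?_⟩
    exact fun hh => hg (Subtype.ext hh)
  · intro p hp
    rw [integral_map hφm.aemeasurable p.continuous.aestronglyMeasurable,
      integral_map hφm.aemeasurable p.continuous.aestronglyMeasurable]
    exact (hadj _ hp).2.2

/-- Finite measures are determined by the integrals of a multiplicative class of `[0, 1]`-valued
functions that generates the σ-field. -/
theorem ext_of_submonoid {m₁ m₂ : Measure S} [IsFiniteMeasure m₁] [IsFiniteMeasure m₂]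
    (M : Submonoid (S → ℝ)) (hmeas : ∀ g ∈ M, Measurable g)
    (hbd : ∀ g ∈ M, ∀ x, g x ∈ Set.Icc (0 : ℝ) 1)
    (hgen : mS ≤ ⨆ g ∈ (M : Set (S → ℝ)), MeasurableSpace.comap g inferInstance)
    (h : ∀ g ∈ M, ∫ x, g x ∂m₁ = ∫ x, g x ∂m₂) : m₁ = m₂ := by
  have huniv : m₁ Set.univ = m₂ Set.univ := by
    have := h 1 M.one_mem
    simp only [Pi.one_apply, integral_const, smul_eq_mul, mul_one, Measure.real] at this
    exact (ENNReal.toReal_eq_toReal_iff' (measure_ne_top _ _) (measure_ne_top _ _)).1 this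
  have hgen' : mS = ⨆ g ∈ (M : Set (S → ℝ)), MeasurableSpace.comap g inferInstance :=
    le_antisymm hgen (iSup₂_le fun g hg => (hmeas g hg).comap_le)
  -- The σ-field is generated by the π-system of events that involve finitely many functions of the
  -- class; on these the finite-dimensional images decide.
  rw [← generateFrom_piiUnionInter_measurableSet] at hgen'
  refine ext_of_generate_finite _ hgen' (isPiSystem_piiUnionInter _
    (fun g => @MeasurableSpace.isPiSystem_measurableSet _ (MeasurableSpace.comap g inferInstance)) _)
    ?_ huniv
  rintro t ⟨J, hJ, c, hc, rfl⟩
  choose! C hC hCc using fun g hg => MeasurableSpace.measurableSet_comap.1 (hc g hg)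
  let I : Finset M := J.attach.map ⟨fun g : J => (⟨g.1, hJ g.2⟩ : M), fun _ _ hab =>
    Subtype.ext (congrArg (fun z : M => (z : S → ℝ)) hab)⟩
  have hI := map_eq_of_submonoid M hmeas hbd h I
  set φ : S → I → Set.Icc (0 : ℝ) 1 := fun x g => ⟨(g : M).1 x, hbd _ (g : M).2 x⟩ with hφ
  have hφm : Measurable φ := measurable_pi_lambda _ fun g => (hmeas _ (g : M).2).subtype_mk
  have hmem : ∀ g : I, ((g : M) : S → ℝ) ∈ J := by
    rintro ⟨g, hg⟩
    simp only [I, Finset.mem_map, Finset.mem_attach, true_and] at hg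
    obtain ⟨a, rfl⟩ := hg
    exact a.2
  have hset : (⋂ g ∈ J, c g) = φ ⁻¹' (Set.univ.pi fun g : I => Subtype.val ⁻¹' (C (g : M))) := by
    ext x
    simp only [Set.mem_iInter, Set.mem_preimage, Set.mem_pi, Set.mem_univ, forall_true_left, hφ]
    constructor
    · intro hx g
      have := hx _ (hmem g)
      rwa [← hCc _ (hmem g)] at this
    · intro hx g hg
      have := hx ⟨⟨g, hJ hg⟩, Finset.mem_map.2 ⟨⟨g, hg⟩, Finset.mem_attach _ _, rfl⟩⟩
      rwa [← hCc _ hg]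
  have hm : MeasurableSet (Set.univ.pi fun g : I => (Subtype.val ⁻¹' (C (g : M)) : Set (Set.Icc (0:ℝ) 1))) :=
    MeasurableSet.univ_pi fun g => measurable_subtype_coe (hC _ (hmem g))
  rw [hset, ← Measure.map_apply hφm hm, ← Measure.map_apply hφm hm, hI]

end MultiplicativeClass

/-! ### The function `e^{-a}` on `[0, ∞]` and its inverse. -/

section Eneg

/-- `e^{-a}` for `a ∈ [0, ∞]`. -/
noncomputable def eneg (a : ℝ≥0∞) : ℝ := (EReal.exp (-(a : EReal))).toReal

theorem eneg_top : eneg ∞ = 0 := by simp [eneg]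

theorem eneg_of_ne_top {a : ℝ≥0∞} (ha : a ≠ ∞) : eneg a = Real.exp (-a.toReal) := by
  lift a to NNReal using ha
  have : (-((a : ℝ≥0∞) : EReal)) = ((-(a : ℝ) : ℝ) : EReal) := by
    rw [EReal.coe_neg]; rfl
  rw [eneg, this, EReal.exp_coe, ENNReal.toReal_ofReal (Real.exp_pos _).le]
  simp

theorem eneg_ofReal {r : ℝ} (hr : 0 ≤ r) : eneg (ENNReal.ofReal r) = Real.exp (-r) := by
  rw [eneg_of_ne_top ENNReal.ofReal_ne_top, ENNReal.toReal_ofReal hr]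

@[simp] theorem eneg_zero : eneg 0 = 1 := by simp [eneg_of_ne_top]

theorem eneg_nonneg (a : ℝ≥0∞) : 0 ≤ eneg a := ENNReal.toReal_nonneg

theorem eneg_le_one (a : ℝ≥0∞) : eneg a ≤ 1 := by
  by_cases ha : a = ∞
  · simp [ha, eneg_top]
  · rw [eneg_of_ne_top ha]; simp

theorem eneg_add (a b : ℝ≥0∞) : eneg (a + b) = eneg a * eneg b := by
  by_cases ha : a = ∞
  · simp [ha, eneg_top]
  by_cases hb : b = ∞
  · simp [hb, eneg_top]
  rw [eneg_of_ne_top ha, eneg_of_ne_top hb, eneg_of_ne_top (by simp [ha, hb]),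
    ENNReal.toReal_add ha hb, neg_add, Real.exp_add]

theorem eneg_sum {ι : Type*} (s : Finset ι) (a : ι → ℝ≥0∞) :
    eneg (∑ i ∈ s, a i) = ∏ i ∈ s, eneg (a i) := by
  classical
  induction s using Finset.induction_on with
  | empty => simp
  | insert i s hi ih => rw [Finset.sum_insert hi, Finset.prod_insert hi, eneg_add, ih]

theorem eneg_mem_Icc (a : ℝ≥0∞) : eneg a ∈ Set.Icc (0 : ℝ) 1 := ⟨eneg_nonneg a, eneg_le_one a⟩

theorem exp_neg_coe_ne_top (a : ℝ≥0∞) : EReal.exp (-(a : EReal)) ≠ ∞ := by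
  simp

@[fun_prop]
theorem continuous_eneg : Continuous eneg := by
  rw [continuous_iff_continuousAt]
  intro a
  refine ContinuousAt.comp (f := fun a : ℝ≥0∞ => EReal.exp (-(a : EReal)))
    (ENNReal.continuousAt_toReal (exp_neg_coe_ne_top a)) ?_
  exact (ENNReal.continuous_exp.comp (continuous_neg.comp continuous_coe_ennreal_ereal)).continuousAt

@[fun_prop]
theorem measurable_eneg : Measurable eneg := continuous_eneg.measurable

theorem eneg_injective : Function.Injective eneg := by
  intro a b hab
  have h := (ENNReal.toReal_eq_toReal_iff' (exp_neg_coe_ne_top a) (exp_neg_coe_ne_top b)).1 hab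
  have h' := EReal.exp_strictMono.injective h
  simpa using h'

/-- An injective continuous map on the standard Borel space `[0, ∞]` is a measurable embedding. -/
theorem measurable_of_measurable_eneg {S : Type*} [MeasurableSpace S] {f : S → ℝ≥0∞}
    (h : Measurable fun x => eneg (f x)) : Measurable f := by
  exact (continuous_eneg.measurableEmbedding eneg_injective).measurable_comp_iff.1 h

/-- `-log u` as a function from `[0, 1]` to `[0, ∞]`. -/
noncomputable def nlog (u : ℝ) : ℝ≥0∞ := if u = 0 then ∞ else ENNReal.ofReal (-Real.log u)

theorem eneg_nlog {u : ℝ} (hu : u ∈ Set.Icc (0 : ℝ) 1) : eneg (nlog u) = u := by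
  rw [nlog]
  split_ifs with h
  · rw [h, eneg_top]
  · rw [eneg_ofReal (by simpa using Real.log_nonpos hu.1 hu.2), neg_neg,
      Real.exp_log (lt_of_le_of_ne hu.1 (Ne.symm h))]

@[fun_prop]
theorem measurable_nlog : Measurable nlog :=
  Measurable.ite (measurableSet_singleton 0) measurable_const (by fun_prop)

end Eneg

theorem measurable_iSup_comap {S : Type*} {M : Set (S → ℝ)} {g : S → ℝ} (hg : g ∈ M) :
    @Measurable _ _ (⨆ g ∈ M, MeasurableSpace.comap g inferInstance) _ g := by
  rw [measurable_iff_comap_le]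
  exact le_iSup₂ (f := fun (g : S → ℝ) (_ : g ∈ M) => MeasurableSpace.comap g inferInstance) g hg

/-! ### Measurability on the space of point measures; exponential functionals. -/

namespace PointMeasure

variable {X : Type*} [MeasurableSpace X]

theorem toMeasure_add (μ ν : PointMeasure X) : (μ + ν).toMeasure = μ.toMeasure + ν.toMeasure := rfl

theorem toMeasure_zero : (0 : PointMeasure X).toMeasure = 0 := rfl

theorem toMeasure_dirac (x : X) : (dirac x).toMeasure = Measure.dirac x := rfl

@[fun_prop]
theorem measurable_toMeasure : Measurable (toMeasure : PointMeasure X → Measure X) :=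
  measurable_subtype_coe

theorem measurable_eval {B : Set X} (hB : MeasurableSet B) :
    Measurable fun μ : PointMeasure X => μ.toMeasure B :=
  (Measure.measurable_coe hB).comp measurable_toMeasure

theorem measurable_iff_toMeasure {S : Type*} [MeasurableSpace S] {φ : S → PointMeasure X} :
    Measurable φ ↔ Measurable fun s => (φ s).toMeasure :=
  ⟨fun h => measurable_toMeasure.comp h, fun h => Measurable.subtype_mk (h := fun s => (φ s).2) h⟩

theorem measurable_iff_eval {S : Type*} [MeasurableSpace S] {φ : S → PointMeasure X} :
    Measurable φ ↔ ∀ B, MeasurableSet B → Measurable fun s => (φ s).toMeasure B := by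
  rw [measurable_iff_toMeasure]
  exact ⟨fun h B hB => (Measure.measurable_coe hB).comp h,
    fun h => Measure.measurable_of_measurable_coe _ h⟩

instance : MeasurableAdd₂ (PointMeasure X) where
  measurable_add := by
    rw [measurable_iff_eval]
    intro B hB
    simp only [toMeasure_add, Measure.add_apply]
    exact ((measurable_eval hB).comp measurable_fst).add ((measurable_eval hB).comp measurable_snd)

@[fun_prop]
theorem measurable_dirac : Measurable (dirac : X → PointMeasure X) := by
  rw [measurable_iff_toMeasure]
  exact Measure.measurable_dirac

theorem measurable_lintegral {h : X → ℝ≥0∞} (hh : Measurable h) :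
    Measurable fun μ : PointMeasure X => ∫⁻ x, h x ∂μ.toMeasure :=
  (Measure.measurable_lintegral hh).comp measurable_toMeasure

/-- The exponential functional `μ ↦ exp (-∫ h dμ)`. -/
def expFun (h : X → ℝ≥0∞) (μ : PointMeasure X) : ℝ := eneg (∫⁻ x, h x ∂μ.toMeasure)

theorem measurable_expFun {h : X → ℝ≥0∞} (hh : Measurable h) : Measurable (expFun h) :=
  measurable_eneg.comp (measurable_lintegral hh)

theorem expFun_nonneg (h : X → ℝ≥0∞) (μ : PointMeasure X) : 0 ≤ expFun h μ := eneg_nonneg _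

theorem expFun_le_one (h : X → ℝ≥0∞) (μ : PointMeasure X) : expFun h μ ≤ 1 := eneg_le_one _

theorem norm_expFun_le (h : X → ℝ≥0∞) (μ : PointMeasure X) : ‖expFun h μ‖ ≤ 1 := by
  rw [Real.norm_of_nonneg (expFun_nonneg h μ)]
  exact expFun_le_one h μ

theorem expFun_zero (μ : PointMeasure X) : expFun (0 : X → ℝ≥0∞) μ = 1 := by simp [expFun]

theorem expFun_fun_add {h k : X → ℝ≥0∞} (hh : Measurable h) (μ : PointMeasure X) :
    expFun (h + k) μ = expFun h μ * expFun k μ := by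
  simp only [expFun, Pi.add_apply]
  rw [lintegral_add_left hh, eneg_add]

theorem expFun_add (h : X → ℝ≥0∞) (μ ν : PointMeasure X) :
    expFun h (μ + ν) = expFun h μ * expFun h ν := by
  simp only [expFun, toMeasure_add]
  rw [lintegral_add_measure, eneg_add]

theorem expFun_dirac {h : X → ℝ≥0∞} (hh : Measurable h) (x : X) :
    expFun h (dirac x) = eneg (h x) := by
  simp only [expFun, toMeasure_dirac]
  rw [lintegral_dirac' x hh]

/-- `Λ`-integral of `1 - e^{-h}`. -/
def lapExp (Λ : Measure X) (h : X → ℝ≥0∞) : ℝ≥0∞ := ∫⁻ x, ENNReal.ofReal (1 - eneg (h x)) ∂Λ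

/-- Measurable functions `h` with `∫ (1 - e^{-h}) dΛ < ∞`. -/
structure IsLap (Λ : Measure X) (h : X → ℝ≥0∞) : Prop where
  meas : Measurable h
  ne_top : lapExp Λ h ≠ ∞

theorem isLap_zero (Λ : Measure X) : IsLap Λ (0 : X → ℝ≥0∞) :=
  ⟨measurable_const, by simp [lapExp]⟩

theorem IsLap.add {Λ : Measure X} {h k : X → ℝ≥0∞} (hh : IsLap Λ h) (hk : IsLap Λ k) :
    IsLap Λ (h + k) := by
  refine ⟨hh.meas.add hk.meas, ne_top_of_le_ne_top (ENNReal.add_ne_top.2 ⟨hh.ne_top, hk.ne_top⟩) ?_⟩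
  rw [lapExp, lapExp, lapExp, ← lintegral_add_left (by have := hh.meas; fun_prop)]
  refine lintegral_mono fun x => ?_
  have h1 := eneg_mem_Icc (h x)
  have h2 := eneg_mem_Icc (k x)
  rw [← ENNReal.ofReal_add (by linarith [h1.2]) (by linarith [h2.2])]
  refine ENNReal.ofReal_le_ofReal ?_
  rw [Pi.add_apply, eneg_add]
  -- The inequality is `1 - ab ≤ (1 - a) + (1 - b)`, that is `(1 - a)(1 - b) ≥ 0`.
  nlinarith [h1.1, h1.2, h2.1, h2.2]

theorem isLap_indicator {Λ : Measure X} {B : Set X} (hB : MeasurableSet B) (hΛ : Λ B ≠ ∞) (c : ℝ≥0∞) :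
    IsLap Λ (B.indicator fun _ => c) := by
  refine ⟨measurable_const.indicator hB, ne_top_of_le_ne_top hΛ ?_⟩
  rw [lapExp, ← lintegral_indicator_one hB]
  refine lintegral_mono fun x => ?_
  by_cases hx : x ∈ B
  · simp [hx, eneg_nonneg]
  · simp [hx]

/-- Taking `h = 1_B` recovers `e^{-μ(B)}`, hence `μ(B)`, for `Λ B < ∞`; a general `B` is exhausted
by such sets. This is what makes the exponential functionals generate the σ-field. -/
theorem measurable_of_expFun (Λ : Measure X) [SigmaFinite Λ] {S : Type*} [MeasurableSpace S]
    {φ : S → PointMeasure X} (hφ : ∀ h, IsLap Λ h → Measurable fun s => expFun h (φ s)) :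
    Measurable φ := by
  have h1 : ∀ B, MeasurableSet B → Λ B ≠ ∞ → Measurable fun s => (φ s).toMeasure B := by
    intro B hB hΛ
    refine measurable_of_measurable_eneg ?_
    have := hφ _ (isLap_indicator hB hΛ 1)
    simp only [expFun] at this
    simpa only [lintegral_indicator_const hB, one_mul] using this
  rw [measurable_iff_eval]
  intro B hB
  have h2 : ∀ s, (φ s).toMeasure B = ⨆ n, (φ s).toMeasure (B ∩ spanningSets Λ n) := by
    intro s
    rw [← Monotone.measure_iUnion (s := fun n => B ∩ spanningSets Λ n)
      (fun i j hij => Set.inter_subset_inter_right _ (monotone_spanningSets Λ hij)),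
      ← Set.inter_iUnion, iUnion_spanningSets, Set.inter_univ]
  simp only [h2]
  refine Measurable.iSup fun n => h1 _ (hB.inter (measurableSet_spanningSets Λ n)) ?_
  exact ((measure_mono Set.inter_subset_right).trans_lt (measure_spanningSets_lt_top Λ n)).ne

/-- The multiplicative class of exponential functionals. -/
def expClass (Λ : Measure X) : Submonoid (PointMeasure X → ℝ) where
  carrier := {g | ∃ h, IsLap Λ h ∧ g = expFun h}
  one_mem' := ⟨0, isLap_zero Λ, by ext μ; rw [expFun_zero, Pi.one_apply]⟩
  mul_mem' := by
    rintro _ _ ⟨h, hh, rfl⟩ ⟨k, hk, rfl⟩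
    exact ⟨h + k, hh.add hk, by ext μ; rw [expFun_fun_add hh.meas, Pi.mul_apply]⟩

/-- Finite measures on `𝐍(X)` are determined by their Laplace functional. -/
theorem ext_of_expFun (Λ : Measure X) [SigmaFinite Λ] {m₁ m₂ : Measure (PointMeasure X)}
    [IsFiniteMeasure m₁] [IsFiniteMeasure m₂]
    (H : ∀ h, IsLap Λ h → ∫ μ, expFun h μ ∂m₁ = ∫ μ, expFun h μ ∂m₂) : m₁ = m₂ := by
  refine ext_of_submonoid (expClass Λ) ?_ ?_ ?_ ?_
  · rintro _ ⟨h, hh, rfl⟩; exact measurable_expFun hh.meas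
  · rintro _ ⟨h, hh, rfl⟩ μ; exact eneg_mem_Icc _
  · have : @Measurable _ _ (⨆ g ∈ (expClass Λ : Set (PointMeasure X → ℝ)),
        MeasurableSpace.comap g inferInstance) _ (id : PointMeasure X → PointMeasure X) := by
      refine @measurable_of_expFun _ _ Λ _ _ (_) _ fun h hh => ?_
      exact measurable_iSup_comap ⟨h, hh, rfl⟩
    rw [measurable_iff_comap_le, MeasurableSpace.comap_id] at this
    exact this
  · rintro _ ⟨h, hh, rfl⟩; exact H h hh

/-- The multiplicative class of products of exponential functionals on `𝐍(X) × 𝐍(X)`. -/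
def expClassProd (Λ : Measure X) : Submonoid (PointMeasure X × PointMeasure X → ℝ) where
  carrier := {g | ∃ h k, IsLap Λ h ∧ IsLap Λ k ∧ g = fun p => expFun h p.1 * expFun k p.2}
  one_mem' := ⟨0, 0, isLap_zero Λ, isLap_zero Λ, by ext μ; simp [expFun_zero]⟩
  mul_mem' := by
    rintro _ _ ⟨h, k, hh, hk, rfl⟩ ⟨h', k', hh', hk', rfl⟩
    refine ⟨h + h', k + k', hh.add hh', hk.add hk', ?_⟩
    ext μ
    rw [expFun_fun_add hh.meas, expFun_fun_add hk.meas, Pi.mul_apply]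
    ring

theorem ext_of_expFun_prod (Λ : Measure X) [SigmaFinite Λ]
    {m₁ m₂ : Measure (PointMeasure X × PointMeasure X)}
    [IsFiniteMeasure m₁] [IsFiniteMeasure m₂]
    (H : ∀ h k, IsLap Λ h → IsLap Λ k →
      ∫ p, expFun h p.1 * expFun k p.2 ∂m₁ = ∫ p, expFun h p.1 * expFun k p.2 ∂m₂) : m₁ = m₂ := by
  refine ext_of_submonoid (expClassProd Λ) ?_ ?_ ?_ ?_
  · rintro _ ⟨h, k, hh, hk, rfl⟩
    exact ((measurable_expFun hh.meas).comp measurable_fst).mul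
      ((measurable_expFun hk.meas).comp measurable_snd)
  · rintro _ ⟨h, k, hh, hk, rfl⟩ μ
    exact ⟨mul_nonneg (expFun_nonneg _ _) (expFun_nonneg _ _),
      mul_le_one₀ (expFun_le_one _ _) (expFun_nonneg _ _) (expFun_le_one _ _)⟩
  · refine sup_le ?_ ?_ <;> rw [← measurable_iff_comap_le]
    · refine @measurable_of_expFun _ _ Λ _ _ (_) _ fun h hh => ?_
      refine measurable_iSup_comap ⟨h, 0, hh, isLap_zero Λ, ?_⟩
      ext p; rw [expFun_zero, mul_one]
    · refine @measurable_of_expFun _ _ Λ _ _ (_) _ fun h hh => ?_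
      refine measurable_iSup_comap ⟨0, h, isLap_zero Λ, hh, ?_⟩
      ext p; rw [expFun_zero, one_mul]
  · rintro _ ⟨h, k, hh, hk, rfl⟩; exact H h k hh hk

end PointMeasure

/-! ### Laplace functionals characterize Poisson processes. -/

/-- Finite measures on `[0, ∞]^ι` are determined by their Laplace transforms. -/
theorem ext_of_eneg_pi {ι : Type*} [Fintype ι] {m₁ m₂ : Measure (ι → ℝ≥0∞)}
    [IsFiniteMeasure m₁] [IsFiniteMeasure m₂]
    (H : ∀ c : ι → ℝ≥0∞, (∀ i, c i ≠ ∞) →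
      ∫ a, ∏ i, eneg (c i * a i) ∂m₁ = ∫ a, ∏ i, eneg (c i * a i) ∂m₂) : m₁ = m₂ := by
  let M : Submonoid ((ι → ℝ≥0∞) → ℝ) :=
    { carrier := {g | ∃ c : ι → ℝ≥0∞, (∀ i, c i ≠ ∞) ∧ g = fun a => ∏ i, eneg (c i * a i)}
      one_mem' := ⟨0, by simp, by ext; simp⟩
      mul_mem' := by
        rintro _ _ ⟨c, hc, rfl⟩ ⟨d, hd, rfl⟩
        refine ⟨c + d, fun i => ENNReal.add_ne_top.2 ⟨hc i, hd i⟩, ?_⟩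
        ext a
        simp only [Pi.mul_apply, Pi.add_apply, add_mul, eneg_add, Finset.prod_mul_distrib] }
  refine ext_of_submonoid M ?_ ?_ ?_ ?_
  · rintro _ ⟨c, hc, rfl⟩; fun_prop
  · rintro _ ⟨c, hc, rfl⟩ a
    exact ⟨Finset.prod_nonneg fun i _ => eneg_nonneg _,
      Finset.prod_le_one (fun i _ => eneg_nonneg _) fun i _ => eneg_le_one _⟩
  · refine iSup_le fun i => ?_
    rw [← measurable_iff_comap_le]
    refine @measurable_of_measurable_eneg _ (_) _ ?_
    classical
    refine measurable_iSup_comap ⟨Pi.single i 1, ?_, ?_⟩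
    · intro j
      by_cases hj : j = i
      · subst hj; simp
      · simp [hj]
    · ext a
      rw [Finset.prod_eq_single i]
      · simp
      · intro j _ hj; simp [hj]
      · simp
  · rintro _ ⟨c, hc, rfl⟩; exact H c hc

theorem measurable_natCast_ennreal : Measurable (fun k : ℕ => (k : ℝ≥0∞)) := .of_discrete

instance isProbabilityMeasure_extPoisson (a : ℝ≥0∞) : IsProbabilityMeasure (extPoisson a) := by
  rw [extPoisson]
  split_ifs
  · infer_instance
  · exact Measure.isProbabilityMeasure_map measurable_natCast_ennreal.aemeasurable

theorem integral_eneg_extPoisson (a : ℝ≥0∞) {c : ℝ≥0∞} (hc : c ≠ ∞) :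
    ∫ y, eneg (c * y) ∂(extPoisson a) = eneg (a * ENNReal.ofReal (1 - eneg c)) := by
  rw [extPoisson]
  split_ifs with ha
  · have hm : Measurable fun y => eneg (c * y) := by fun_prop
    rw [integral_dirac' _ _ hm.stronglyMeasurable, ha]
    -- In infinite mean, `c = 0` gives `1` on both sides because `∞ * 0 = 0`, and `c ≠ 0` gives
    -- `e^{-∞} = 0`.
    by_cases h0 : c = 0
    · simp [h0]
    · have h1 : 0 < 1 - eneg c := by
        rw [eneg_of_ne_top hc, sub_pos, Real.exp_lt_one_iff, neg_lt_zero]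
        exact ENNReal.toReal_pos h0 hc
      rw [ENNReal.mul_top h0, ENNReal.top_mul (by simpa using h1)]
  · have hm : Measurable fun y => eneg (c * y) := by fun_prop
    rw [integral_map measurable_natCast_ennreal.aemeasurable hm.aestronglyMeasurable,
      integral_poissonMeasure]
    set r := a.toNNReal with hr
    have har : a = r := (ENNReal.coe_toNNReal ha).symm
    have h1 : ∀ n : ℕ, eneg (c * n) = eneg c ^ n := by
      intro n
      rw [mul_comm, ← nsmul_eq_mul, ← Fin.sum_const, eneg_sum]
      simp
    have hs : HasSum (fun n : ℕ => (Real.exp (-r) * r ^ n / (n.factorial : ℝ)) • eneg (c * n))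
        (Real.exp (-r) * Real.exp (r * eneg c)) := by
      have := (NormedSpace.expSeries_div_hasSum_exp ((r : ℝ) * eneg c)).mul_left (Real.exp (-r))
      rw [← Real.exp_eq_exp_ℝ] at this
      refine this.congr_fun fun n => ?_
      rw [h1, smul_eq_mul, mul_pow]
      ring
    rw [hs.tsum_eq, ← Real.exp_add, har, eneg_of_ne_top (a := _ * _) (by finiteness)]
    rw [ENNReal.toReal_mul, ENNReal.toReal_ofReal (by linarith [eneg_le_one c])]
    congr 1
    simp only [ENNReal.coe_toReal]
    ring

namespace PointMeasure

variable {X Ω : Type*} [MeasurableSpace X] [MeasurableSpace Ω]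

/-- The level sets are listed by `Fin n` to match the families in `IsPoissonProcess.indep`. -/
theorem lintegral_simpleFunc_eq (s : SimpleFunc X ℝ≥0∞) (m : Measure X) {n : ℕ}
    (e : Fin n ≃ s.range) :
    ∫⁻ x, s x ∂m = ∑ i, (e i : ℝ≥0∞) * m (s ⁻¹' {(e i : ℝ≥0∞)}) := by
  rw [SimpleFunc.lintegral_eq_lintegral, SimpleFunc.lintegral,
    ← Finset.sum_coe_sort, ← e.sum_comp]

theorem lapExp_simpleFunc (s : SimpleFunc X ℝ≥0∞) (m : Measure X) {n : ℕ}
    (e : Fin n ≃ s.range) :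
    lapExp m s = ∑ i, m (s ⁻¹' {(e i : ℝ≥0∞)}) * ENNReal.ofReal (1 - eneg (e i)) := by
  have : lapExp m s = ∫⁻ x, (s.map fun c => ENNReal.ofReal (1 - eneg c)) x ∂m := rfl
  rw [this, SimpleFunc.lintegral_eq_lintegral, SimpleFunc.map_lintegral,
    ← Finset.sum_coe_sort, ← e.sum_comp]
  exact Finset.sum_congr rfl fun i _ => mul_comm _ _

theorem tendsto_lintegral_eapprox {h : X → ℝ≥0∞} (hh : Measurable h) (m : Measure X) :
    Tendsto (fun n => ∫⁻ x, SimpleFunc.eapprox h n x ∂m) atTop (𝓝 (∫⁻ x, h x ∂m)) := by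
  refine lintegral_tendsto_of_tendsto_of_monotone (fun n => (SimpleFunc.measurable _).aemeasurable)
    (ae_of_all _ fun x i j hij => SimpleFunc.monotone_eapprox h hij x)
    (ae_of_all _ fun x => SimpleFunc.tendsto_eapprox hh x)

theorem eneg_antitone : Antitone eneg := by
  intro a b hab
  obtain ⟨c, rfl⟩ := exists_add_of_le hab
  rw [eneg_add]
  exact mul_le_of_le_one_right (eneg_nonneg _) (eneg_le_one _)

theorem tendsto_lapExp_eapprox {h : X → ℝ≥0∞} (hh : Measurable h) (m : Measure X) :
    Tendsto (fun n => lapExp m (SimpleFunc.eapprox h n)) atTop (𝓝 (lapExp m h)) := by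
  refine lintegral_tendsto_of_tendsto_of_monotone (fun n => ?_)
    (ae_of_all _ fun x i j hij => ?_) (ae_of_all _ fun x => ?_)
  · have := (SimpleFunc.eapprox h n).measurable
    fun_prop
  · refine ENNReal.ofReal_le_ofReal (sub_le_sub_left (eneg_antitone ?_) _)
    exact SimpleFunc.monotone_eapprox h hij x
  · exact ((ENNReal.continuous_ofReal.comp
      (continuous_const.sub continuous_eneg)).tendsto _).comp (SimpleFunc.tendsto_eapprox hh x)

/-- The Laplace functional of a Poisson process. -/
theorem _root_.IsPoissonProcess.integral_expFun {P : Measure Ω} [IsProbabilityMeasure P]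
    {η : Ω → PointMeasure X} {Λ : Measure X} (hη : IsPoissonProcess P η Λ)
    {h : X → ℝ≥0∞} (hh : Measurable h) :
    ∫ ω, expFun h (η ω) ∂P = eneg (lapExp Λ h) := by
  have hsimple : ∀ s : SimpleFunc X ℝ≥0∞, (∀ x, s x ≠ ∞) →
      ∫ ω, expFun s (η ω) ∂P = eneg (lapExp Λ s) := by
    intro s hs
    let e : Fin s.range.card ≃ s.range := (Finset.equivFin _).symm
    have hfin : ∀ i, (e i : ℝ≥0∞) ≠ ∞ := by
      intro i
      obtain ⟨x, hx⟩ := SimpleFunc.mem_range.1 (e i).2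
      rw [← hx]; exact hs x
    have hB : ∀ i, MeasurableSet (s ⁻¹' {(e i : ℝ≥0∞)}) := fun i => s.measurableSet_preimage _
    have hdisj : Pairwise fun i j => Disjoint (s ⁻¹' {(e i : ℝ≥0∞)}) (s ⁻¹' {(e j : ℝ≥0∞)}) := by
      intro i j hij
      refine Disjoint.preimage _ ?_
      rw [Set.disjoint_singleton]
      exact fun hh => hij (e.injective (Subtype.ext hh))
    have hind := hη.indep _ _ hB hdisj
    simp only [expFun, lintegral_simpleFunc_eq s _ e, eneg_sum, lapExp_simpleFunc s Λ e]
    rw [iIndepFun.integral_fun_prod_comp (f := fun i y => eneg (e i * y)) hind]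
    · refine Finset.prod_congr rfl fun i _ => ?_
      rw [← integral_eneg_extPoisson _ (hfin i), ← hη.map_eval _ (hB i), integral_map]
      · exact ((measurable_eval (hB i)).comp hη.measurable).aemeasurable
      · exact (by fun_prop : Measurable fun y => eneg (e i * y)).aestronglyMeasurable
    · exact fun i => ((measurable_eval (hB i)).comp hη.measurable).aemeasurable
    · exact fun i => (by fun_prop : Measurable fun y => eneg (e i * y)).aestronglyMeasurable
  -- From simple functions to `h`: monotone convergence in each exponent, then dominated convergence
  -- with bound `1`.
  have h1 : Tendsto (fun n => ∫ ω, expFun (SimpleFunc.eapprox h n) (η ω) ∂P) atTop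
      (𝓝 (∫ ω, expFun h (η ω) ∂P)) := by
    refine tendsto_integral_of_dominated_convergence (fun _ => 1) (fun n => ?_)
      (integrable_const _) (fun n => ae_of_all _ fun ω => norm_expFun_le _ _)
      (ae_of_all _ fun ω => ?_)
    · exact ((measurable_expFun (SimpleFunc.measurable _)).comp hη.measurable).aestronglyMeasurable
    · exact (continuous_eneg.tendsto _).comp (tendsto_lintegral_eapprox hh _)
  refine tendsto_nhds_unique h1 ?_
  simp only [hsimple _ fun x => (SimpleFunc.eapprox_lt_top h _ x).ne]
  exact (continuous_eneg.tendsto _).comp (tendsto_lapExp_eapprox hh _)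

/-- A random measure with the Laplace functional of a Poisson process is a Poisson process. -/
theorem isPoissonProcess_of_integral_expFun {P : Measure Ω} [IsProbabilityMeasure P]
    {η : Ω → PointMeasure X} {Λ : Measure X} (hm : Measurable η)
    (H : ∀ h : X → ℝ≥0∞, Measurable h → ∫ ω, expFun h (η ω) ∂P = eneg (lapExp Λ h)) :
    IsPoissonProcess P η Λ := by
  -- The joint law on disjoint sets is a product of Poisson laws; this gives both the marginals (`m
  -- = 1`) and independence.
  have key : ∀ (m : ℕ) (B : Fin m → Set X), (∀ i, MeasurableSet (B i)) →
      Pairwise (fun i j => Disjoint (B i) (B j)) →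
      P.map (fun ω i => (η ω).toMeasure (B i)) = Measure.pi fun i => extPoisson (Λ (B i)) := by
    intro m B hB hd
    have hmm : Measurable fun ω i => (η ω).toMeasure (B i) :=
      measurable_pi_lambda _ fun i => (measurable_eval (hB i)).comp hm
    refine ext_of_eneg_pi fun c hc => ?_
    rw [integral_map hmm.aemeasurable
      (by fun_prop : Measurable fun a : Fin m → ℝ≥0∞ => ∏ i, eneg (c i * a i)).aestronglyMeasurable,
      integral_fintype_prod_eq_prod (fun i y => eneg (c i * y))]
    simp only [integral_eneg_extPoisson _ (hc _)]
    set h : X → ℝ≥0∞ := fun x => ∑ i, (B i).indicator (fun _ => c i) x with hh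
    have hhm : Measurable h := Finset.measurable_fun_sum _ fun i _ => measurable_const.indicator (hB i)
    have h1 : ∀ ω, expFun h (η ω) = ∏ i, eneg (c i * (η ω).toMeasure (B i)) := by
      intro ω
      rw [expFun, hh, lintegral_finsetSum _ fun i _ => measurable_const.indicator (hB i), eneg_sum]
      simp only [lintegral_indicator_const (hB _)]
    have h2 : lapExp Λ h = ∑ i, Λ (B i) * ENNReal.ofReal (1 - eneg (c i)) := by
      -- By disjointness at most one summand of `h` is nonzero at `x`, so `1 - e^{-h}` splits along
      -- the sets.
      have : ∀ x, ENNReal.ofReal (1 - eneg (h x)) =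
          ∑ i, (B i).indicator (fun _ => ENNReal.ofReal (1 - eneg (c i))) x := by
        intro x
        by_cases hx : ∃ i, x ∈ B i
        · obtain ⟨i, hi⟩ := hx
          have hne : ∀ j, j ≠ i → x ∉ B j := fun j hj hxj =>
            Set.disjoint_left.1 (hd hj) hxj hi
          simp only [hh]
          rw [Finset.sum_eq_single i (fun j _ hj => by simp [hne j hj]) (by simp),
            Finset.sum_eq_single i (fun j _ hj => by simp [hne j hj]) (by simp)]
          simp [hi]
        · push Not at hx
          simp [hh, hx]
      simp only [lapExp, this]
      rw [lintegral_finsetSum _ fun i _ => measurable_const.indicator (hB i)]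
      simp only [lintegral_indicator_const (hB _), mul_comm]
    simp only [← h1]
    rw [H h hhm, h2, eneg_sum]
  have hmi : ∀ B, MeasurableSet B → Measurable fun ω => (η ω).toMeasure B :=
    fun B hB => (measurable_eval hB).comp hm
  refine ⟨hm, fun B hB => ?_, fun m B hB hd => ?_⟩
  · have h1 := key 1 (fun _ => B) (fun _ => hB) (fun i j hij => (hij (Subsingleton.elim _ _)).elim)
    have h2 := congrArg (fun ν => ν.map (fun a : Fin 1 → ℝ≥0∞ => a 0)) h1
    rw [(measurePreserving_eval (fun _ : Fin 1 => extPoisson (Λ B)) 0).map_eq,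
      Measure.map_map (measurable_pi_apply 0)
      (measurable_pi_lambda _ fun i => hmi _ hB)] at h2
    exact h2
  · rw [iIndepFun_iff_map_fun_eq_pi_map fun i => (hmi _ (hB i)).aemeasurable, key m B hB hd]
    congr with i : 1
    have h2 := congrArg (fun ν => ν.map (fun a : Fin m → ℝ≥0∞ => a i)) (key m B hB hd)
    rw [(measurePreserving_eval (fun i => extPoisson (Λ (B i))) i).map_eq,
      Measure.map_map (measurable_pi_apply i)
      (measurable_pi_lambda _ fun i => hmi _ (hB i))] at h2
    exact h2.symm

/-- The law `Π_Λ` is the law of any Poisson process with intensity measure `Λ`. -/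
theorem _root_.IsPoissonProcess.poissonLaw_eq {P : Measure Ω} [IsProbabilityMeasure P]
    {η : Ω → PointMeasure X} {Λ : Measure X} [SigmaFinite Λ] (hη : IsPoissonProcess P η Λ) :
    poissonLaw Λ = P.map η := by
  have hP : IsProbabilityMeasure (P.map η) :=
    Measure.isProbabilityMeasure_map hη.measurable.aemeasurable
  have hex : ∃ Q : Measure (PointMeasure X),
      IsProbabilityMeasure Q ∧ IsPoissonProcess Q (fun μ => μ) Λ := by
    refine ⟨P.map η, hP, isPoissonProcess_of_integral_expFun measurable_id fun h hh => ?_⟩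
    rw [integral_map hη.measurable.aemeasurable (measurable_expFun hh).aestronglyMeasurable,
      hη.integral_expFun hh]
  rw [poissonLaw, dif_pos hex]
  have h1 := hex.choose_spec.1
  have h2 := hex.choose_spec.2
  refine ext_of_expFun Λ fun h hh => ?_
  rw [h2.integral_expFun hh.meas,
    integral_map hη.measurable.aemeasurable (measurable_expFun hh.meas).aestronglyMeasurable,
      hη.integral_expFun hh.meas]

end PointMeasure

/-! ### Thinnings and their joint Laplace functional with `η`. -/

namespace PointMeasure

variable {X Ω : Type*} [MeasurableSpace X] [MeasurableSpace Ω]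

/-- The relation between a Poisson process `η` and its `t`-thinnings `ζ t`, expressed through
joint Laplace functionals. -/
structure IsThinningFamily (P : Measure Ω) (Λ : Measure X) (η : Ω → PointMeasure X)
    (ζ : ℝ → Ω → PointMeasure X) : Prop where
  meas_base : Measurable η
  meas_thin : Measurable fun p : ℝ × Ω => ζ p.1 p.2
  laplace : ∀ t ∈ Set.Icc (0 : ℝ) 1, ∀ h k : X → ℝ≥0∞, Measurable h → Measurable k →
    ∫ ω, expFun h (ζ t ω) * expFun k (η ω) ∂P =
      eneg (∫⁻ x, ENNReal.ofReal (1 - (t * (eneg (h x) * eneg (k x)) + (1 - t) * eneg (k x))) ∂Λ)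

theorem integral_comp_bool {P : Measure Ω} [IsProbabilityMeasure P] {Z : Ω → Bool}
    (hZ : Measurable Z) {t : ℝ} (ht : t ∈ Set.Icc (0 : ℝ) 1)
    (hp : P {ω | Z ω = true} = ENNReal.ofReal t) (g : Bool → ℝ) :
    ∫ ω, g (Z ω) ∂P = t * g true + (1 - t) * g false := by
  have hs : MeasurableSet {ω | Z ω = true} := hZ (measurableSet_singleton true)
  have h1 : ∀ ω, g (Z ω) = g false + {ω | Z ω = true}.indicator (fun _ => g true - g false) ω := by
    intro ω
    by_cases h : Z ω = true
    · simp [h]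
    · simp [h]
  simp only [h1]
  rw [integral_add (integrable_const _) ((integrable_const _).indicator hs),
    integral_indicator_const _ hs, integral_const,
    measureReal_def P {ω | Z ω = true}, hp, ENNReal.toReal_ofReal ht.1]
  simp only [probReal_univ, smul_eq_mul]
  ring

/-- Independence factorizes the finite partial sums, and dominated convergence passes to the series.
Writing each factor as `e^{-nlog u}` turns the infinite product into a sum in `[0, ∞]`, which always
converges. -/
theorem integral_eneg_tsum_bool {P : Measure Ω} [IsProbabilityMeasure P] {Z : ℕ → Ω → Bool}
    (hZ : ∀ n, Measurable (Z n)) {t : ℝ} (ht : t ∈ Set.Icc (0 : ℝ) 1)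
    (hp : ∀ n, P {ω | Z n ω = true} = ENNReal.ofReal t) (hind : iIndepFun Z P)
    (w : ℕ → Bool → ℝ≥0∞) :
    ∫ ω, eneg (∑' n, w n (Z n ω)) ∂P =
      eneg (∑' n, nlog (t * eneg (w n true) + (1 - t) * eneg (w n false))) := by
  have hu : ∀ n, t * eneg (w n true) + (1 - t) * eneg (w n false) ∈ Set.Icc (0 : ℝ) 1 := by
    intro n
    have h1 := eneg_mem_Icc (w n true)
    have h2 := eneg_mem_Icc (w n false)
    constructor
    · exact add_nonneg (mul_nonneg ht.1 h1.1) (mul_nonneg (by linarith [ht.2]) h2.1)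
    · nlinarith [ht.1, ht.2, h1.2, h2.2]
  have hfin : ∀ m : ℕ, ∫ ω, eneg (∑ n ∈ Finset.range m, w n (Z n ω)) ∂P =
      eneg (∑ n ∈ Finset.range m, nlog (t * eneg (w n true) + (1 - t) * eneg (w n false))) := by
    intro m
    have hind' : iIndepFun (fun i : Fin m => Z i) P := hind.precomp Fin.val_injective
    simp only [eneg_sum, eneg_nlog (hu _), Finset.prod_range]
    rw [iIndepFun.integral_fun_prod_comp (f := fun (i : Fin m) b => eneg (w i b)) hind'
      (fun i => (hZ i).aemeasurable) (fun i => Measurable.of_discrete.aestronglyMeasurable)]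
    exact Finset.prod_congr rfl fun i _ => integral_comp_bool (hZ i) ht (hp i) fun b => eneg (w i b)
  have h1 : Tendsto (fun m : ℕ => ∫ ω, eneg (∑ n ∈ Finset.range m, w n (Z n ω)) ∂P) atTop
      (𝓝 (∫ ω, eneg (∑' n, w n (Z n ω)) ∂P)) := by
    refine tendsto_integral_of_dominated_convergence (fun _ => 1) (fun n => ?_)
      (integrable_const _) (fun n => ae_of_all _ fun ω => ?_) (ae_of_all _ fun ω => ?_)
    · refine (measurable_eneg.comp (Finset.measurable_fun_sum _ fun i _ => ?_)).aestronglyMeasurable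
      exact (Measurable.of_discrete (f := w i)).comp (hZ i)
    · rw [Real.norm_of_nonneg (eneg_nonneg _)]; exact eneg_le_one _
    · exact (continuous_eneg.tendsto _).comp ENNReal.summable.hasSum.tendsto_sum_nat
  refine tendsto_nhds_unique h1 ?_
  simp only [hfin]
  exact (continuous_eneg.tendsto _).comp ENNReal.summable.hasSum.tendsto_sum_nat

theorem toMeasure_ofMeasure {m : Measure X} (h : IsPointMeasure m) :
    (ofMeasure m).toMeasure = m := by
  have : ofMeasure m = ⟨m, h⟩ := dif_pos h
  rw [this]
  rfl

/-- The sub-sum of Dirac measures with indices in `A`. -/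
theorem isPointMeasure_sum_of_le {A : ℕ → Prop} [DecidablePred A] {C : ℕ → Prop} [DecidablePred C]
    {x : ℕ → X} (hAC : ∀ n, A n → C n)
    (hC : IsPointMeasure (Measure.sum fun n => if C n then Measure.dirac (x n) else 0)) :
    IsPointMeasure (Measure.sum fun n => if A n then Measure.dirac (x n) else 0) := by
  classical
  refine ⟨?_, fun B hB => ?_⟩
  · have := hC.1
    refine Measure.sigmaFinite_of_le (Measure.sum fun n => if C n then Measure.dirac (x n) else 0) ?_
    refine Measure.le_iff.2 fun s hs => ?_
    rw [Measure.sum_apply _ hs, Measure.sum_apply _ hs]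
    refine ENNReal.tsum_le_tsum fun n => ?_
    by_cases h : A n
    · simp [h, hAC n h]
    · simp [h]
  -- The mass of `B` is the number of retained indices whose point lies in `B`.
  · refine ⟨{n | A n ∧ x n ∈ B}.encard, ?_⟩
    rw [Measure.sum_apply _ hB, ← ENNReal.tsum_set_one, tsum_subtype {n | A n ∧ x n ∈ B} (fun _ => 1)]
    refine tsum_congr fun n => ?_
    by_cases h : A n
    · by_cases hx : x n ∈ B <;> simp [h, hx, Measure.dirac_apply' _ hB]
    · simp [h]

theorem lintegral_sum_dirac {h : X → ℝ≥0∞} (hh : Measurable h) (A : ℕ → Prop) [DecidablePred A]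
    (x : ℕ → X) :
    ∫⁻ y, h y ∂(Measure.sum fun n => if A n then Measure.dirac (x n) else 0) =
      ∑' n, if A n then h (x n) else 0 := by
  rw [lintegral_sum_measure]
  refine tsum_congr fun n => ?_
  split_ifs
  · rw [lintegral_dirac' _ hh]
  · simp

/-- The thinning, set to `0` outside of `G`. -/
def thinOn (κ : Ω → ℕ∞) (ξ : ℕ → Ω → X) (Y : ℝ → ℕ → Ω → Bool) (G : Set Ω) (t : ℝ) (ω : Ω) :
    PointMeasure X :=
  open scoped Classical in if ω ∈ G then thinning κ ξ Y t ω else 0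

open scoped Classical in
omit [MeasurableSpace Ω] in
theorem toMeasure_thinning {η : Ω → PointMeasure X} {κ : Ω → ℕ∞} {ξ : ℕ → Ω → X}
    (Y : ℝ → ℕ → Ω → Bool) (t : ℝ) {ω : Ω}
    (hω : (η ω).toMeasure =
      Measure.sum (fun n : ℕ => if (n : ℕ∞) < κ ω then Measure.dirac (ξ n ω) else 0)) :
    (thinning κ ξ Y t ω).toMeasure = Measure.sum (fun n : ℕ =>
      if (n : ℕ∞) < κ ω ∧ Y t n ω = true then Measure.dirac (ξ n ω) else 0) := by
  have h1 : IsPointMeasure (Measure.sum (fun n : ℕ =>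
      if (n : ℕ∞) < κ ω ∧ Y t n ω = true then Measure.dirac (ξ n ω) else 0)) := by
    refine isPointMeasure_sum_of_le (C := fun n => (n : ℕ∞) < κ ω) (fun n h => h.1) ?_
    rw [← hω]
    exact (η ω).2
  exact toMeasure_ofMeasure h1

/-- Given the points, marks act independently: a point at `x` contributes the mean factor `u(x) = t
e^{-h(x)-k(x)} + (1-t) e^{-k(x)}`. The conditional expectation is therefore `exp (-∫ nlog u dη)`, to
which the Laplace functional of `η` applies. The set `G` secures measurability everywhere, although
the representation holds only almost surely. -/
theorem isThinningFamily_thinOn {P : Measure Ω} [IsProbabilityMeasure P] {Λ : Measure X}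
    {η : Ω → PointMeasure X} (hη : IsPoissonProcess P η Λ)
    {κ : Ω → ℕ∞} {ξ : ℕ → Ω → X} (hκξ : IsProperRepr P η κ ξ)
    {Y : ℝ → ℕ → Ω → Bool} (hY : IsThinningMarks P κ ξ Y) {G : Set Ω} (hG : MeasurableSet G)
    (hGae : ∀ᵐ ω ∂P, ω ∈ G) (hGr : ∀ ω ∈ G, (η ω).toMeasure =
      Measure.sum (fun n : ℕ => open scoped Classical in
        if (n : ℕ∞) < κ ω then Measure.dirac (ξ n ω) else 0)) :
    IsThinningFamily P Λ η (thinOn κ ξ Y G) := by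
  classical
  have hκ := hκξ.measurable_card
  have hξ := hκξ.measurable_point
  refine ⟨hη.measurable, ?_, ?_⟩
  · rw [measurable_iff_eval]
    intro B hB
    have h1 : ∀ p : ℝ × Ω, (thinOn κ ξ Y G p.1 p.2).toMeasure B = if p.2 ∈ G then
        ∑' n : ℕ, if (n : ℕ∞) < κ p.2 ∧ Y p.1 n p.2 = true then
          B.indicator (1 : X → ℝ≥0∞) (ξ n p.2) else 0 else 0 := by
      rintro ⟨t, ω⟩
      by_cases hω : ω ∈ G
      · simp only [thinOn, hω, if_true]
        rw [toMeasure_thinning Y t (hGr ω hω), ← lintegral_indicator_one hB,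
          lintegral_sum_dirac (measurable_one.indicator hB)]
      · simp [thinOn, hω, toMeasure_zero]
    simp only [h1]
    refine Measurable.ite (measurable_snd hG) (Measurable.tsum fun n => ?_) measurable_const
    refine Measurable.ite (MeasurableSet.inter ?_ ?_) ?_ measurable_const
    · exact (hκ.comp measurable_snd) (MeasurableSet.of_discrete (s := {k : ℕ∞ | (n : ℕ∞) < k}))
    · exact (hY.measurable n) (measurableSet_singleton true)
    · exact (measurable_one.indicator hB).comp ((hξ n).comp measurable_snd)
  · intro t ht h k hh hk
    have hYm : ∀ n, Measurable (Y t n) := fun n =>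
      (hY.measurable n).comp (measurable_const.prodMk measurable_id)
    -- The exponent contributed by the point of index `n` with mark `b`; indices beyond `κ`
    -- contribute `0`.
    let w : ℕ → (ℕ∞ × (ℕ → X)) → Bool → ℝ≥0∞ := fun n z b =>
      if (n : ℕ∞) < z.1 then (if b = true then h (z.2 n) else 0) + k (z.2 n) else 0
    let u : X → ℝ := fun x => t * (eneg (h x) * eneg (k x)) + (1 - t) * eneg (k x)
    have hu : ∀ x, u x ∈ Set.Icc (0 : ℝ) 1 := by
      intro x
      have h1 := eneg_mem_Icc (h x)
      have h2 := eneg_mem_Icc (k x)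
      have h3 : eneg (h x) * eneg (k x) ≤ 1 := mul_le_one₀ h1.2 h2.1 h2.2
      constructor
      · exact add_nonneg (mul_nonneg ht.1 (mul_nonneg h1.1 h2.1))
          (mul_nonneg (by linarith [ht.2]) h2.1)
      · simp only [u]; nlinarith [ht.1, ht.2, h1.2, h2.2]
    have hum : Measurable u := by fun_prop
    have hnm : Measurable fun x => nlog (u x) := by fun_prop
    have hw : Measurable fun p : (ℕ → Bool) × (ℕ∞ × (ℕ → X)) => eneg (∑' n, w n p.2 (p.1 n)) := by
      refine measurable_eneg.comp (Measurable.tsum fun n => ?_)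
      refine Measurable.ite ?_ (Measurable.add (Measurable.ite ?_ ?_ measurable_const) ?_)
        measurable_const
      · exact (measurable_fst.comp measurable_snd)
          (MeasurableSet.of_discrete (s := {k : ℕ∞ | (n : ℕ∞) < k}))
      · exact ((measurable_pi_apply (X := fun _ => Bool) n).comp measurable_fst)
          (measurableSet_singleton true)
      · exact hh.comp ((measurable_pi_apply n).comp (measurable_snd.comp measurable_snd))
      · exact hk.comp ((measurable_pi_apply n).comp (measurable_snd.comp measurable_snd))
    have hYpi : Measurable fun ω n => Y t n ω := measurable_pi_lambda _ hYm
    have hz : Measurable fun ω => (κ ω, fun n => ξ n ω) := hκ.prodMk (measurable_pi_lambda _ hξ)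
    have e1 : ∫ ω, expFun h (thinOn κ ξ Y G t ω) * expFun k (η ω) ∂P =
        ∫ ω, eneg (∑' n, w n (κ ω, fun n => ξ n ω) (Y t n ω)) ∂P := by
      refine integral_congr_ae ?_
      filter_upwards [hGae] with ω hω
      simp only [thinOn, hω, if_true, expFun]
      rw [toMeasure_thinning Y t (hGr ω hω), hGr ω hω, lintegral_sum_dirac hh,
        lintegral_sum_dirac hk, ← eneg_add, ← ENNReal.tsum_add]
      congr 1
      refine tsum_congr fun n => ?_
      by_cases h1 : (n : ℕ∞) < κ ω <;> simp [w, h1]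
    have e2 : ∫ ω, eneg (∑' n, w n (κ ω, fun n => ξ n ω) (Y t n ω)) ∂P =
        ∫ ω, eneg (∑' n : ℕ, if (n : ℕ∞) < κ ω then nlog (u (ξ n ω)) else 0) ∂P := by
      -- Independence of marks and points allows `(κ, ξ)` to be frozen while the marks are
      -- integrated out.
      have hlaw := (indepFun_iff_map_prod_eq_prod_map_map hYpi.aemeasurable hz.aemeasurable).1
        (hY.indep t ht)
      have := Measure.isProbabilityMeasure_map (μ := P) hYpi.aemeasurable
      have := Measure.isProbabilityMeasure_map (μ := P) hz.aemeasurable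
      have hI : Integrable (fun p : (ℕ → Bool) × (ℕ∞ × (ℕ → X)) => eneg (∑' n, w n p.2 (p.1 n)))
          ((P.map fun ω n => Y t n ω).prod (P.map fun ω => (κ ω, fun n => ξ n ω))) := by
        refine Integrable.of_bound hw.aestronglyMeasurable 1 (ae_of_all _ fun p => ?_)
        rw [Real.norm_of_nonneg (eneg_nonneg _)]; exact eneg_le_one _
      rw [← integral_map (f := fun p : (ℕ → Bool) × (ℕ∞ × (ℕ → X)) => eneg (∑' n, w n p.2 (p.1 n)))
        (hYpi.prodMk hz).aemeasurable hw.aestronglyMeasurable, hlaw, integral_prod_symm _ hI,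
        integral_map hz.aemeasurable]
      · refine integral_congr_ae (ae_of_all _ fun ω => ?_)
        simp only
        rw [integral_map hYpi.aemeasurable]
        · simp only
          rw [integral_eneg_tsum_bool hYm ht (hY.prob t ht) (hY.iIndep t ht)
            fun n => w n (κ ω, fun n => ξ n ω)]
          congr 1
          refine tsum_congr fun n => ?_
          by_cases h1 : (n : ℕ∞) < κ ω
          · simp [w, h1, u, eneg_add]
          · simp [w, h1, nlog]
        · exact (hw.comp (measurable_id.prodMk measurable_const)).aestronglyMeasurable
      · exact hI.aestronglyMeasurable.prod_swap.integral_prod_right'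
    have e3 : ∫ ω, eneg (∑' n : ℕ, if (n : ℕ∞) < κ ω then nlog (u (ξ n ω)) else 0) ∂P =
        ∫ ω, expFun (fun x => nlog (u x)) (η ω) ∂P := by
      refine integral_congr_ae ?_
      filter_upwards [hGae] with ω hω
      rw [expFun, hGr ω hω, lintegral_sum_dirac hnm]
    rw [e1, e2, e3, hη.integral_expFun hnm, lapExp]
    simp only [eneg_nlog (hu _)]
    rfl

end PointMeasure

/-! ### Moments, the Mecke formula, and an `L¹` bound for `D f`. -/

theorem lintegral_extPoisson (a : ℝ≥0∞) : ∫⁻ y, y ∂(extPoisson a) = a := by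
  rw [extPoisson]
  split_ifs with ha
  · rw [lintegral_dirac' _ measurable_id', ha]
  · rw [lintegral_map measurable_id' measurable_natCast_ennreal]
    set r := a.toNNReal with hr
    have har : a = r := (ENNReal.coe_toNNReal ha).symm
    have h1 : ∀ n : ℕ, ENNReal.ofReal (Real.exp (-r) * r ^ (n + 1) / ((n + 1).factorial : ℝ)) *
        ((n + 1 : ℕ) : ℝ≥0∞) = r * ENNReal.ofReal (Real.exp (-r) * r ^ n / (n.factorial : ℝ)) := by
      intro n
      rw [← ENNReal.ofReal_natCast, ← ENNReal.ofReal_mul (by positivity), ← ENNReal.ofReal_coe_nnreal,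
        ← ENNReal.ofReal_mul (by positivity)]
      congr 1
      rw [Nat.factorial_succ]
      push_cast
      field_simp
      ring
    have h2 : ∑' n : ℕ, ENNReal.ofReal (Real.exp (-r) * r ^ n / (n.factorial : ℝ)) = 1 := by
      rw [← ENNReal.ofReal_tsum_of_nonneg (fun n => by positivity)
        (hasSum_one_poissonMeasure r).summable, (hasSum_one_poissonMeasure r).tsum_eq,
        ENNReal.ofReal_one]
    rw [poissonMeasure, lintegral_sum_measure]
    simp only [lintegral_smul_measure, lintegral_dirac, smul_eq_mul]
    rw [tsum_eq_zero_add' ENNReal.summable]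
    simp only [h1, ENNReal.tsum_mul_left, h2]
    simp [har]

namespace PointMeasure

variable {X Ω : Type*} [MeasurableSpace X] [MeasurableSpace Ω]

theorem _root_.IsPoissonProcess.lintegral_eval {P : Measure Ω} {η : Ω → PointMeasure X}
    {Λ : Measure X} (hη : IsPoissonProcess P η Λ) {B : Set X} (hB : MeasurableSet B) :
    ∫⁻ ω, (η ω).toMeasure B ∂P = Λ B := by
  have hηB : Measurable fun ω => (η ω).toMeasure B := (measurable_eval hB).comp hη.measurable
  rw [← lintegral_extPoisson (Λ B), ← hη.map_eval B hB, lintegral_map measurable_id' hηB]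

theorem tendsto_inv_mul_one_sub_exp (b : ℝ) :
    Tendsto (fun s : ℝ => s⁻¹ * (1 - Real.exp (-(s * b)))) (𝓝[>] 0) (𝓝 b) := by
  have h : HasDerivAt (fun s : ℝ => 1 - Real.exp (-(s * b))) b 0 := by
    have := ((((hasDerivAt_id (0 : ℝ)).mul_const b).neg).exp).const_sub 1
    simpa using this
  simpa using h.tendsto_slope_zero_right

theorem one_sub_exp_neg_le (y : ℝ) : 1 - Real.exp (-y) ≤ y := by
  linarith [Real.add_one_le_exp (-y)]

theorem expFun_smul_indicator {B : Set X} (hB : MeasurableSet B) (c : ℝ≥0∞) (μ : PointMeasure X) :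
    expFun (B.indicator fun _ => c) μ = eneg (c * μ.toMeasure B) := by
  rw [expFun, lintegral_indicator_const hB]

/-- The Mecke formula tested on exponential functionals. -/
theorem _root_.IsPoissonProcess.integral_expFun_mul_eval {P : Measure Ω} [IsProbabilityMeasure P]
    {η : Ω → PointMeasure X} {Λ : Measure X} (hη : IsPoissonProcess P η Λ) {B : Set X}
    (hB : MeasurableSet B) (hΛ : Λ B ≠ ∞) {h : X → ℝ≥0∞} (hh : IsLap Λ h) :
    ∫ ω, expFun h (η ω) * ((η ω).toMeasure B).toReal ∂P =
      (∫ ω, expFun h (η ω) ∂P) * ∫ x in B, eneg (h x) ∂Λ := by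
  have hηB : Measurable fun ω => (η ω).toMeasure B := (measurable_eval hB).comp hη.measurable
  have hmh : Measurable fun ω => expFun h (η ω) := (measurable_expFun hh.meas).comp hη.measurable
  have hfin : ∀ᵐ ω ∂P, (η ω).toMeasure B < ∞ :=
    ae_lt_top hηB (by rw [hη.lintegral_eval hB]; exact hΛ)
  have hint : Integrable (fun ω => ((η ω).toMeasure B).toReal) P :=
    integrable_toReal_of_lintegral_ne_top hηB.aemeasurable (by rw [hη.lintegral_eval hB]; exact hΛ)
  set b := ∫ x in B, eneg (h x) ∂Λ with hb
  set lam := lapExp Λ h with hlam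
  have hbint : IntegrableOn (fun x => eneg (h x)) B Λ := by
    have : IsFiniteMeasure (Λ.restrict B) := ⟨by simpa using hΛ.lt_top⟩
    refine Integrable.of_bound (measurable_eneg.comp hh.meas).aestronglyMeasurable 1
      (ae_of_all _ fun x => ?_)
    rw [Real.norm_of_nonneg (eneg_nonneg _)]; exact eneg_le_one _
  have hb0 : 0 ≤ b := integral_nonneg fun x => eneg_nonneg _
  -- The formula is the derivative at `s = 0+` of the Laplace functional along `h + s 1_B`, whose
  -- exponent is computed here.
  have hlamn : ∀ s : ℝ, 0 < s → lapExp Λ (h + B.indicator fun _ => ENNReal.ofReal s) =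
      lam + ENNReal.ofReal ((1 - Real.exp (-s)) * b) := by
    intro s hs
    have hs1 : 0 ≤ 1 - Real.exp (-s) := by
      have : Real.exp (-s) ≤ 1 := Real.exp_le_one_iff.2 (by linarith)
      linarith
    rw [hb, ENNReal.ofReal_mul hs1, ofReal_integral_eq_lintegral_ofReal hbint
      (ae_of_all _ fun x => eneg_nonneg _), ← lintegral_const_mul' _ _ ENNReal.ofReal_ne_top,
      ← lintegral_indicator hB, hlam, lapExp, lapExp, ← lintegral_add_left]
    · refine lintegral_congr fun x => ?_
      by_cases hx : x ∈ B
      · rw [Set.indicator_of_mem hx, Pi.add_apply, Set.indicator_of_mem hx, eneg_add,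
          eneg_ofReal hs.le, ← ENNReal.ofReal_mul hs1,
          ← ENNReal.ofReal_add (by linarith [eneg_le_one (h x)]) (mul_nonneg hs1 (eneg_nonneg _))]
        congr 1; ring
      · simp [hx]
    · have := hh.meas; fun_prop
  have e1 : ∀ s : ℝ, 0 < s → s⁻¹ * (eneg lam - eneg lam * Real.exp (-((1 - Real.exp (-s)) * b))) =
      ∫ ω, expFun h (η ω) * (s⁻¹ * (1 - eneg (ENNReal.ofReal s * (η ω).toMeasure B))) ∂P := by
    intro s hs
    have hs1 : 0 ≤ 1 - Real.exp (-s) := by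
      have : Real.exp (-s) ≤ 1 := Real.exp_le_one_iff.2 (by linarith)
      linarith
    have hmi : Measurable (B.indicator fun _ => ENNReal.ofReal s) := measurable_const.indicator hB
    have h1 := hη.integral_expFun (hh.meas.add hmi)
    rw [hlamn s hs, eneg_add, eneg_ofReal (mul_nonneg hs1 hb0)] at h1
    rw [← h1, ← hη.integral_expFun hh.meas, ← integral_sub, ← integral_const_mul]
    · refine integral_congr_ae (ae_of_all _ fun ω => ?_)
      simp only
      rw [expFun_fun_add hh.meas, expFun_smul_indicator hB]
      ring
    · exact Integrable.of_bound hmh.aestronglyMeasurable 1 (ae_of_all _ fun x => norm_expFun_le _ _)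
    · exact Integrable.of_bound ((measurable_expFun (hh.meas.add hmi)).comp
        hη.measurable).aestronglyMeasurable 1 (ae_of_all _ fun x => norm_expFun_le _ _)
  have t1 : Tendsto (fun s : ℝ => ∫ ω, expFun h (η ω) *
      (s⁻¹ * (1 - eneg (ENNReal.ofReal s * (η ω).toMeasure B))) ∂P) (𝓝[>] 0)
      (𝓝 (∫ ω, expFun h (η ω) * ((η ω).toMeasure B).toReal ∂P)) := by
    have hform : ∀ s : ℝ, 0 < s → ∀ ω, (η ω).toMeasure B < ∞ →
        eneg (ENNReal.ofReal s * (η ω).toMeasure B) =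
          Real.exp (-(s * ((η ω).toMeasure B).toReal)) := by
      intro s hs ω hω
      rw [eneg_of_ne_top (ENNReal.mul_ne_top ENNReal.ofReal_ne_top hω.ne), ENNReal.toReal_mul,
        ENNReal.toReal_ofReal hs.le]
    -- The difference quotients are dominated by `η(B)`, since `1 - e^{-sy} ≤ sy`, and `η(B)` has
    -- finite mean `Λ B`.
    refine tendsto_integral_filter_of_dominated_convergence
      (fun ω => ((η ω).toMeasure B).toReal) ?_ ?_ hint ?_
    · filter_upwards with s
      exact (hmh.mul (by fun_prop)).aestronglyMeasurable
    · filter_upwards [self_mem_nhdsWithin] with s hs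
      filter_upwards [hfin] with ω hω
      have hs0 : (0 : ℝ) < s := hs
      set y := ((η ω).toMeasure B).toReal with hy
      have hy0 : 0 ≤ y := ENNReal.toReal_nonneg
      rw [hform s hs ω hω, norm_mul]
      have h2 : 0 ≤ 1 - Real.exp (-(s * y)) := by
        have : Real.exp (-(s * y)) ≤ 1 := Real.exp_le_one_iff.2 (by nlinarith)
        linarith
      rw [Real.norm_of_nonneg (mul_nonneg (inv_nonneg.2 hs0.le) h2)]
      have h3 : s⁻¹ * (1 - Real.exp (-(s * y))) ≤ y := by
        rw [inv_mul_le_iff₀ hs0]; exact one_sub_exp_neg_le _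
      calc _ ≤ 1 * y := mul_le_mul (norm_expFun_le _ _) h3
            (mul_nonneg (inv_nonneg.2 hs0.le) h2) zero_le_one
        _ = y := one_mul y
    · filter_upwards [hfin] with ω hω
      refine Tendsto.const_mul _ ?_
      refine (tendsto_inv_mul_one_sub_exp ((η ω).toMeasure B).toReal).congr' ?_
      filter_upwards [self_mem_nhdsWithin] with s hs
      rw [hform s hs ω hω]
  have t2 : Tendsto (fun s : ℝ => s⁻¹ * (eneg lam - eneg lam *
      Real.exp (-((1 - Real.exp (-s)) * b)))) (𝓝[>] 0) (𝓝 (eneg lam * b)) := by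
    have h : HasDerivAt (fun s : ℝ => eneg lam - eneg lam *
        Real.exp (-((1 - Real.exp (-s)) * b))) (eneg lam * b) 0 := by
      have h0 : HasDerivAt (fun s : ℝ => 1 - Real.exp (-s)) 1 0 := by
        simpa using ((hasDerivAt_id (0 : ℝ)).neg.exp).const_sub 1
      have := (((h0.mul_const b).neg.exp).const_mul (eneg lam)).const_sub (eneg lam)
      simpa using this
    simpa using h.tendsto_slope_zero_right
  rw [hη.integral_expFun hh.meas]
  refine tendsto_nhds_unique t1 (t2.congr' ?_)
  filter_upwards [self_mem_nhdsWithin] with s hs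
  exact e1 s hs

/-- The Mecke formula on sets of finite intensity. -/
theorem _root_.IsPoissonProcess.mecke {P : Measure Ω} [IsProbabilityMeasure P]
    {η : Ω → PointMeasure X} {Λ : Measure X} [SigmaFinite Λ] (hη : IsPoissonProcess P η Λ)
    {B : Set X} (hB : MeasurableSet B) (hΛ : Λ B ≠ ∞) {f : PointMeasure X → ℝ≥0∞}
    (hf : Measurable f) :
    ∫⁻ x in B, ∫⁻ ω, f (η ω + dirac x) ∂P ∂Λ = ∫⁻ ω, f (η ω) * (η ω).toMeasure B ∂P := by
  have hηB : Measurable fun ω => (η ω).toMeasure B := (measurable_eval hB).comp hη.measurable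
  have hfin : IsFiniteMeasure (Λ.restrict B) := ⟨by simpa using hΛ.lt_top⟩
  have hηm := hη.measurable
  have hfin2 : IsFiniteMeasure (P.withDensity fun ω => (η ω).toMeasure B) :=
    isFiniteMeasure_withDensity (by rw [hη.lintegral_eval hB]; exact hΛ)
  have hadd : Measurable fun p : Ω × X => η p.1 + dirac p.2 := by fun_prop
  -- Adding a point multiplies an exponential functional by `e^{-h(x)}`, so the left side factorizes
  -- and both finite measures have equal Laplace functionals.
  have key : (P.prod (Λ.restrict B)).map (fun p : Ω × X => η p.1 + dirac p.2) =
      (P.withDensity fun ω => (η ω).toMeasure B).map η := by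
    refine ext_of_expFun Λ fun h hh => ?_
    have hmh := measurable_expFun hh.meas
    rw [integral_map hadd.aemeasurable hmh.aestronglyMeasurable,
      integral_map hηm.aemeasurable hmh.aestronglyMeasurable]
    simp only [expFun_add, expFun_dirac hh.meas]
    rw [integral_prod_mul (fun ω => expFun h (η ω)) (fun x => eneg (h x)),
      ← hη.integral_expFun_mul_eval hB hΛ hh, integral_withDensity_eq_integral_toReal_smul hηB]
    · simp only [smul_eq_mul, mul_comm]
    · exact ae_lt_top hηB (by rw [hη.lintegral_eval hB]; exact hΛ)
  have h1 := congrArg (fun m => ∫⁻ μ, f μ ∂m) key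
  rw [lintegral_map hf hadd, lintegral_map hf hηm,
    lintegral_prod_symm _ (by fun_prop),
    lintegral_withDensity_eq_lintegral_mul _ hηB (by fun_prop)] at h1
  rw [h1]
  exact lintegral_congr fun ω => mul_comm _ _

/-- The Mecke formula for `μ ↦ μ(B)` reduces the second moment to the mean of `(η + δ_x)(B)`, which
is at most `Λ B + 1`. -/
theorem _root_.IsPoissonProcess.lintegral_eval_sq {P : Measure Ω} [IsProbabilityMeasure P]
    {η : Ω → PointMeasure X} {Λ : Measure X} [SigmaFinite Λ] (hη : IsPoissonProcess P η Λ)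
    {B : Set X} (hB : MeasurableSet B) (hΛ : Λ B ≠ ∞) :
    ∫⁻ ω, (η ω).toMeasure B * (η ω).toMeasure B ∂P ≠ ∞ := by
  have hηB : Measurable fun ω => (η ω).toMeasure B := (measurable_eval hB).comp hη.measurable
  rw [← hη.mecke hB hΛ (measurable_eval hB)]
  have : ∀ x, ∫⁻ ω, (η ω + dirac x).toMeasure B ∂P ≤ Λ B + 1 := by
    intro x
    simp only [toMeasure_add, Measure.add_apply, toMeasure_dirac]
    rw [lintegral_add_left hηB, hη.lintegral_eval hB, lintegral_const, measure_univ, mul_one]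
    gcongr
    exact prob_le_one
  refine ne_top_of_le_ne_top ?_ (lintegral_mono this)
  rw [lintegral_const]
  simp only [Measure.restrict_apply_univ]
  finiteness

/-- The `L¹`-norm of `D f` over a set of finite intensity is controlled by the `L²`-norm of `f`. -/
theorem _root_.IsPoissonProcess.exists_lintegral_diffOp_le {P : Measure Ω} [IsProbabilityMeasure P]
    {η : Ω → PointMeasure X} {Λ : Measure X} [SigmaFinite Λ] (hη : IsPoissonProcess P η Λ)
    {B : Set X} (hB : MeasurableSet B) (hΛ : Λ B ≠ ∞) :
    ∃ C : ℝ≥0∞, C ≠ ∞ ∧ ∀ f : PointMeasure X → ℝ, Measurable f →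
      ∫⁻ x in B, ∫⁻ ω, ‖diffOp x f (η ω)‖ₑ ∂P ∂Λ ≤ C * eLpNorm (fun ω => f (η ω)) 2 P := by
  have hηB : Measurable fun ω => (η ω).toMeasure B := (measurable_eval hB).comp hη.measurable
  have hηm := hη.measurable
  -- The constant is the `L²`-norm of `η(B) + Λ(B)`: Mecke turns the shifted term into the weight
  -- `η(B)`, the unshifted one has weight `Λ(B)`, and Cauchy–Schwarz follows.
  refine ⟨(∫⁻ ω, ((η ω).toMeasure B + Λ B) ^ (2 : ℝ) ∂P) ^ (1 / 2 : ℝ), ?_, fun f hf => ?_⟩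
  · refine ENNReal.rpow_ne_top_of_nonneg (by norm_num) ?_
    have : ∀ ω, ((η ω).toMeasure B + Λ B) ^ (2 : ℝ) =
        (η ω).toMeasure B * (η ω).toMeasure B + (2 * Λ B * (η ω).toMeasure B + Λ B * Λ B) := by
      intro ω
      rw [ENNReal.rpow_two]; ring
    simp only [this]
    rw [lintegral_add_left (by fun_prop), lintegral_add_left (by fun_prop),
      lintegral_const_mul _ hηB, hη.lintegral_eval hB, lintegral_const, measure_univ]
    have := hη.lintegral_eval_sq hB hΛ
    finiteness
  · have hfe : Measurable fun μ => ‖f μ‖ₑ := hf.enorm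
    calc ∫⁻ x in B, ∫⁻ ω, ‖diffOp x f (η ω)‖ₑ ∂P ∂Λ
        ≤ ∫⁻ x in B, ((∫⁻ ω, ‖f (η ω + dirac x)‖ₑ ∂P) + ∫⁻ ω, ‖f (η ω)‖ₑ ∂P) ∂Λ := by
          refine lintegral_mono fun x => ?_
          rw [← lintegral_add_left (by fun_prop)]
          exact lintegral_mono fun ω => enorm_sub_le
      _ = ∫⁻ ω, ‖f (η ω)‖ₑ * ((η ω).toMeasure B + Λ B) ∂P := by
          rw [lintegral_add_right _ measurable_const, hη.mecke hB hΛ hfe, lintegral_const,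
            Measure.restrict_apply_univ]
          simp only [mul_add]
          rw [lintegral_add_left (by fun_prop), lintegral_mul_const _ (by fun_prop)]
      _ ≤ (∫⁻ ω, ‖f (η ω)‖ₑ ^ (2 : ℝ) ∂P) ^ (1 / 2 : ℝ) *
          (∫⁻ ω, ((η ω).toMeasure B + Λ B) ^ (2 : ℝ) ∂P) ^ (1 / 2 : ℝ) :=
          ENNReal.lintegral_mul_le_Lp_mul_Lq P Real.HolderConjugate.two_two
            (hfe.comp hηm).aemeasurable (hηB.add_const _).aemeasurable
      _ = _ := by
          rw [mul_comm, eLpNorm_eq_lintegral_rpow_enorm_toReal (by norm_num) (by norm_num)]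
          simp

end PointMeasure

/-! ### The pair `(ζ_t, η)` and the Clark–Ocone integrand. -/

namespace PointMeasure

variable {X Ω : Type*} [MeasurableSpace X] [MeasurableSpace Ω]

theorem lapExp_smul {Λ : Measure X} {h : X → ℝ≥0∞} (c : ℝ≥0∞) :
    lapExp (c • Λ) h = c * lapExp Λ h := by
  rw [lapExp, lintegral_smul_measure, smul_eq_mul, lapExp]

theorem expFun_zero' (μ : PointMeasure X) : expFun (fun _ : X => (0 : ℝ≥0∞)) μ = 1 := expFun_zero μ

namespace IsThinningFamily

variable {P : Measure Ω} [IsProbabilityMeasure P] {Λ : Measure X} {η : Ω → PointMeasure X}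
  {ζ : ℝ → Ω → PointMeasure X} (hT : IsThinningFamily P Λ η ζ)

include hT

theorem measurable_thin (t : ℝ) : Measurable (ζ t) :=
  hT.meas_thin.comp (measurable_const.prodMk measurable_id)

theorem isPoissonProcess_base : IsPoissonProcess P η Λ := by
  refine isPoissonProcess_of_integral_expFun hT.meas_base fun k hk => ?_
  have := hT.laplace 0 (by simp) (fun _ => 0) k measurable_const hk
  simpa [expFun_zero', lapExp] using this

theorem isPoissonProcess_thin {t : ℝ} (ht : t ∈ Set.Icc (0 : ℝ) 1) :
    IsPoissonProcess P (ζ t) (ENNReal.ofReal t • Λ) := by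
  refine isPoissonProcess_of_integral_expFun (hT.measurable_thin t) fun h hh => ?_
  have := hT.laplace t ht h (fun _ => 0) hh measurable_const
  simp only [expFun_zero', mul_one, eneg_zero] at this
  rw [this, lapExp_smul, lapExp, ← lintegral_const_mul _ (by fun_prop)]
  congr 1
  refine lintegral_congr fun x => ?_
  rw [← ENNReal.ofReal_mul ht.1]
  congr 1
  ring

theorem poissonLaw_eq [SigmaFinite Λ] {t : ℝ} (ht : t ∈ Set.Icc (0 : ℝ) 1) :
    poissonLaw (ENNReal.ofReal t • Λ) = P.map (ζ t) := by
  have : SigmaFinite (ENNReal.ofReal t • Λ) :=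
    inferInstanceAs (SigmaFinite (Real.toNNReal t • Λ))
  exact (hT.isPoissonProcess_thin ht).poissonLaw_eq

theorem integral_expFun_thin {t : ℝ} (ht : t ∈ Set.Icc (0 : ℝ) 1) {h : X → ℝ≥0∞}
    (hh : Measurable h) : ∫ ω, expFun h (ζ t ω) ∂P = eneg (ENNReal.ofReal t * lapExp Λ h) := by
  rw [(hT.isPoissonProcess_thin ht).integral_expFun hh, lapExp_smul]

/-- `(ζ_t, η)` has the law of `(ζ_t, ζ_t + ζ'_{1-t})` with an independent copy `ζ'`. -/
theorem map_pair_eq [SigmaFinite Λ] {t : ℝ} (ht : t ∈ Set.Icc (0 : ℝ) 1) :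
    P.map (fun ω => (ζ t ω, η ω)) =
      (P.prod P).map (fun p => (ζ t p.1, ζ t p.1 + ζ (1 - t) p.2)) := by
  have ht' : 1 - t ∈ Set.Icc (0 : ℝ) 1 := ⟨by linarith [ht.2], by linarith [ht.1]⟩
  have m1 := hT.measurable_thin t
  have m2 := hT.measurable_thin (1 - t)
  have m3 := hT.meas_base
  refine ext_of_expFun_prod Λ fun h k hh hk => ?_
  have mh := measurable_expFun hh.meas
  have mk := measurable_expFun hk.meas
  rw [integral_map (by fun_prop) (by fun_prop), integral_map (by fun_prop) (by fun_prop)]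
  simp only [expFun_add, ← mul_assoc, ← expFun_fun_add hh.meas]
  rw [integral_prod_mul (fun ω => expFun (h + k) (ζ t ω)) (fun ω => expFun k (ζ (1 - t) ω)),
    hT.laplace t ht h k hh.meas hk.meas, hT.integral_expFun_thin ht (hh.meas.add hk.meas),
    hT.integral_expFun_thin ht' hk.meas, ← eneg_add]
  have n1 := hh.meas
  have n2 := hk.meas
  rw [lapExp, lapExp, ← lintegral_const_mul _ (by simp only [Pi.add_apply]; fun_prop),
    ← lintegral_const_mul _ (by fun_prop),
    ← lintegral_add_left (by simp only [Pi.add_apply]; fun_prop)]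
  congr 1
  -- Pointwise, with `a = e^{-h(x)}` and `b = e^{-k(x)}`: `t(1 - ab) + (1-t)(1 - b) = 1 - (t ab +
  -- (1-t) b)`.
  refine lintegral_congr fun x => ?_
  rw [← ENNReal.ofReal_mul ht.1, ← ENNReal.ofReal_mul ht'.1, ← ENNReal.ofReal_add]
  · congr 1
    rw [Pi.add_apply, eneg_add]; ring
  · exact mul_nonneg ht.1 (by linarith [eneg_le_one ((h + k) x)])
  · exact mul_nonneg ht'.1 (by linarith [eneg_le_one (k x)])

theorem lintegral_pair [SigmaFinite Λ] {t : ℝ} (ht : t ∈ Set.Icc (0 : ℝ) 1)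
    {g : PointMeasure X × PointMeasure X → ℝ≥0∞} (hg : Measurable g) :
    ∫⁻ ω, ∫⁻ ω', g (ζ t ω, ζ t ω + ζ (1 - t) ω') ∂P ∂P = ∫⁻ ω, g (ζ t ω, η ω) ∂P := by
  have m1 := hT.measurable_thin t
  have m2 := hT.measurable_thin (1 - t)
  have m3 := hT.meas_base
  have h := congrArg (fun m => ∫⁻ p, g p ∂m) (hT.map_pair_eq ht)
  rw [lintegral_map hg (by fun_prop), lintegral_map hg (by fun_prop),
    lintegral_prod _ (by fun_prop)] at h
  exact h.symm

end IsThinningFamily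

/-- The integrand `(t, x, ω) ↦ E'[D_x f(ζ_t + ζ'_{1-t})]` of the Clark–Ocone representation. -/
def clark (P : Measure Ω) (ζ : ℝ → Ω → PointMeasure X) (f : PointMeasure X → ℝ)
    (p : (ℝ × X) × Ω) : ℝ :=
  ∫ ω', diffOp p.1.2 f (ζ p.1.1 p.2 + ζ (1 - p.1.1) ω') ∂P

/-- The measure `dt ⊗ Λ ⊗ P` on `(0, 1] × X × Ω`. -/
def clarkMeasure (P : Measure Ω) (Λ : Measure X) : Measure ((ℝ × X) × Ω) :=
  ((volume.restrict (Set.Ioc (0 : ℝ) 1)).prod Λ).prod P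

theorem measurable_diffOp {S : Type*} [MeasurableSpace S] {f : PointMeasure X → ℝ}
    (hf : Measurable f) {x : S → X} {φ : S → PointMeasure X} (hx : Measurable x)
    (hφ : Measurable φ) : Measurable fun s => diffOp (x s) f (φ s) := by
  unfold diffOp
  fun_prop

namespace IsThinningFamily

variable {P : Measure Ω} [IsProbabilityMeasure P] {Λ : Measure X} {η : Ω → PointMeasure X}
  {ζ : ℝ → Ω → PointMeasure X} (hT : IsThinningFamily P Λ η ζ)

include hT

theorem measurable_sum :
    Measurable fun q : ((ℝ × X) × Ω) × Ω => ζ q.1.1.1 q.1.2 + ζ (1 - q.1.1.1) q.2 := by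
  have h1 : Measurable fun q : ((ℝ × X) × Ω) × Ω => ζ q.1.1.1 q.1.2 :=
    hT.meas_thin.comp (by fun_prop : Measurable fun q : ((ℝ × X) × Ω) × Ω => (q.1.1.1, q.1.2))
  have h2 : Measurable fun q : ((ℝ × X) × Ω) × Ω => ζ (1 - q.1.1.1) q.2 :=
    hT.meas_thin.comp (by fun_prop : Measurable fun q : ((ℝ × X) × Ω) × Ω => (1 - q.1.1.1, q.2))
  exact h1.add h2

theorem measurable_diffOp_sum {f : PointMeasure X → ℝ} (hf : Measurable f) :
    Measurable fun q : ((ℝ × X) × Ω) × Ω =>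
      diffOp q.1.1.2 f (ζ q.1.1.1 q.1.2 + ζ (1 - q.1.1.1) q.2) :=
  measurable_diffOp hf (by fun_prop) hT.measurable_sum

theorem stronglyMeasurable_clark {f : PointMeasure X → ℝ} (hf : Measurable f) :
    StronglyMeasurable (clark P ζ f) :=
  (hT.measurable_diffOp_sum hf).stronglyMeasurable.integral_prod_right'

/-- Integrating out both copies turns `ζ_t + ζ'_{1-t}` into `η`. -/
theorem lintegral_diffOp_sum [SigmaFinite Λ] {f : PointMeasure X → ℝ} (hf : Measurable f)
    (B : Set X) :
    ∫⁻ p in (Set.univ ×ˢ B) ×ˢ Set.univ, ∫⁻ ω',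
      ‖diffOp p.1.2 f (ζ p.1.1 p.2 + ζ (1 - p.1.1) ω')‖ₑ ∂P ∂(clarkMeasure P Λ) =
      ∫⁻ x in B, ∫⁻ ω, ‖diffOp x f (η ω)‖ₑ ∂P ∂Λ := by
  have hm := (hT.measurable_diffOp_sum hf).enorm
  rw [clarkMeasure, ← Measure.prod_restrict, ← Measure.prod_restrict, Measure.restrict_univ,
    Measure.restrict_univ, lintegral_prod _ hm.lintegral_prod_right'.aemeasurable,
    lintegral_prod _ hm.lintegral_prod_right'.lintegral_prod_right'.aemeasurable]
  have h1 : ∀ t ∈ Set.Ioc (0 : ℝ) 1, ∀ x : X,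
      ∫⁻ ω, ∫⁻ ω', ‖diffOp x f (ζ t ω + ζ (1 - t) ω')‖ₑ ∂P ∂P =
        ∫⁻ ω, ‖diffOp x f (η ω)‖ₑ ∂P := by
    intro t ht x
    exact hT.lintegral_pair ⟨ht.1.le, ht.2⟩ (g := fun q => ‖diffOp x f q.2‖ₑ)
      (measurable_diffOp hf measurable_const measurable_snd).enorm
  rw [setLIntegral_congr_fun (g := fun _ => ∫⁻ x in B, ∫⁻ ω, ‖diffOp x f (η ω)‖ₑ ∂P ∂Λ)
    measurableSet_Ioc fun t ht => lintegral_congr fun x => h1 t ht x]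
  simp

theorem lintegral_clark_le [SigmaFinite Λ] {f : PointMeasure X → ℝ} (hf : Measurable f)
    (B : Set X) :
    ∫⁻ p in (Set.univ ×ˢ B) ×ˢ Set.univ, ‖clark P ζ f p‖ₑ ∂(clarkMeasure P Λ) ≤
      ∫⁻ x in B, ∫⁻ ω, ‖diffOp x f (η ω)‖ₑ ∂P ∂Λ := by
  rw [← hT.lintegral_diffOp_sum hf _]
  exact lintegral_mono fun p => enorm_integral_le_lintegral_enorm _

/-- The `L¹` bound on each spanning set shows that the Bochner integral in `clark` is almost
everywhere a genuine one and not the default value `0`. -/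
theorem ae_integrable_diffOp_sum [SigmaFinite Λ] {f : PointMeasure X → ℝ} (hf : Measurable f)
    (hf2 : MemLp (fun ω => f (η ω)) 2 P) :
    ∀ᵐ p ∂(clarkMeasure P Λ),
      Integrable (fun ω' => diffOp p.1.2 f (ζ p.1.1 p.2 + ζ (1 - p.1.1) ω')) P := by
  have hm := (hT.measurable_diffOp_sum hf).enorm
  have h1 : ∀ n, ∀ᵐ p ∂(clarkMeasure P Λ), p ∈ (Set.univ ×ˢ spanningSets Λ n) ×ˢ Set.univ →
      Integrable (fun ω' => diffOp p.1.2 f (ζ p.1.1 p.2 + ζ (1 - p.1.1) ω')) P := by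
    intro n
    have hB := measurableSet_spanningSets Λ n
    obtain ⟨C, hC, hCf⟩ := hT.isPoissonProcess_base.exists_lintegral_diffOp_le hB
      (measure_spanningSets_lt_top Λ n).ne
    have hset : MeasurableSet ((Set.univ ×ˢ spanningSets Λ n) ×ˢ Set.univ : Set ((ℝ × X) × Ω)) :=
      (MeasurableSet.univ.prod hB).prod MeasurableSet.univ
    rw [← ae_restrict_iff' hset]
    have h2 := hT.lintegral_diffOp_sum hf (spanningSets Λ n)
    have h3 := ae_lt_top (μ := (clarkMeasure P Λ).restrict
        ((Set.univ ×ˢ spanningSets Λ n) ×ˢ Set.univ)) hm.lintegral_prod_right' (by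
      rw [h2]
      exact ne_top_of_le_ne_top (ENNReal.mul_ne_top hC hf2.2.ne) (hCf f hf))
    filter_upwards [h3] with p hp
    exact ⟨((hT.measurable_diffOp_sum hf).comp
      (measurable_const.prodMk measurable_id)).aestronglyMeasurable, hp⟩
  filter_upwards [ae_all_iff.2 h1] with p hp
  refine hp (spanningSetsIndex Λ p.1.2) ⟨⟨Set.mem_univ _, ?_⟩, Set.mem_univ _⟩
  exact mem_spanningSetsIndex Λ p.1.2

theorem clark_sub_ae [SigmaFinite Λ] {f g : PointMeasure X → ℝ} (hf : Measurable f)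
    (hf2 : MemLp (fun ω => f (η ω)) 2 P) (hg : Measurable g)
    (hg2 : MemLp (fun ω => g (η ω)) 2 P) :
    clark P ζ (f - g) =ᵐ[clarkMeasure P Λ] clark P ζ f - clark P ζ g := by
  filter_upwards [hT.ae_integrable_diffOp_sum hf hf2, hT.ae_integrable_diffOp_sum hg hg2]
    with p h1 h2
  rw [Pi.sub_apply, clark, clark, clark, ← integral_sub h1 h2]
  refine integral_congr_ae (ae_of_all _ fun ω => ?_)
  simp only [diffOp, Pi.sub_apply]
  ring

end IsThinningFamily

end PointMeasure

/-! ### Two facts on `L²`-norms and inner products. -/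

section L2

variable {α β : Type*} [MeasurableSpace α] [MeasurableSpace β]

theorem tendsto_integral_mul_of_eLpNorm {μ : Measure α} {u w : ℕ → α → ℝ} {u₀ w₀ : α → ℝ}
    (hu : ∀ n, MemLp (u n) 2 μ) (hw : ∀ n, MemLp (w n) 2 μ) (hu₀ : MemLp u₀ 2 μ)
    (hw₀ : MemLp w₀ 2 μ) (hut : Tendsto (fun n => eLpNorm (u n - u₀) 2 μ) atTop (𝓝 0))
    (hwt : Tendsto (fun n => eLpNorm (w n - w₀) 2 μ) atTop (𝓝 0)) :
    Tendsto (fun n => ∫ x, u n x * w n x ∂μ) atTop (𝓝 (∫ x, u₀ x * w₀ x ∂μ)) := by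
  have h1 := (Lp.tendsto_Lp_iff_tendsto_eLpNorm'' u hu u₀ hu₀).2 hut
  have h2 := (Lp.tendsto_Lp_iff_tendsto_eLpNorm'' w hw w₀ hw₀).2 hwt
  have key : ∀ {a b : α → ℝ} (ha : MemLp a 2 μ) (hb : MemLp b 2 μ),
      inner ℝ (ha.toLp a) (hb.toLp b) = ∫ x, a x * b x ∂μ := by
    intro a b ha hb
    rw [L2.inner_def]
    refine integral_congr_ae ?_
    filter_upwards [ha.coeFn_toLp, hb.coeFn_toLp] with x hx hy
    rw [hx, hy]
    simp [mul_comm]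
  simpa only [key] using h1.inner (𝕜 := ℝ) h2

theorem eLpNorm_two_le_of_integral_le {μ : Measure α} {ν : Measure β} {u : α → ℝ} {w : β → ℝ}
    (hu : MemLp u 2 μ) (hw : MemLp w 2 ν) (h : ∫ x, u x * u x ∂μ ≤ ∫ x, w x * w x ∂ν) :
    eLpNorm u 2 μ ≤ eLpNorm w 2 ν := by
  rw [hu.eLpNorm_eq_integral_rpow_norm (by norm_num) (by norm_num),
    hw.eLpNorm_eq_integral_rpow_norm (by norm_num) (by norm_num)]
  refine ENNReal.ofReal_le_ofReal ?_
  simp only [ENNReal.toReal_ofNat, Real.rpow_ofNat, Real.norm_eq_abs, sq_abs]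
  simp only [← pow_two] at h
  exact Real.rpow_le_rpow (integral_nonneg fun _ => sq_nonneg _) h (by norm_num)

end L2

/-! ### The covariance identity on the span of exponential functionals. -/

namespace PointMeasure

variable {X Ω : Type*} [MeasurableSpace X] [MeasurableSpace Ω]

/-- The linear span of the exponential functionals. -/
def expSpan (Λ : Measure X) : Submodule ℝ (PointMeasure X → ℝ) :=
  Submodule.span ℝ {g | ∃ h, IsLap Λ h ∧ g = expFun h}

theorem expFun_mem_expSpan {Λ : Measure X} {h : X → ℝ≥0∞} (hh : IsLap Λ h) :
    expFun h ∈ expSpan Λ := Submodule.subset_span ⟨h, hh, rfl⟩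

theorem measurable_of_mem_expSpan {Λ : Measure X} {f : PointMeasure X → ℝ} (hf : f ∈ expSpan Λ) :
    Measurable f := by
  induction hf using Submodule.span_induction with
  | mem f hf => obtain ⟨h, hh, rfl⟩ := hf; exact measurable_expFun hh.meas
  | zero => exact measurable_const
  | add a b _ _ ha hb => exact ha.add hb
  | smul c a _ ha => exact ha.const_smul c

theorem exists_bound_of_mem_expSpan {Λ : Measure X} {f : PointMeasure X → ℝ}
    (hf : f ∈ expSpan Λ) : ∃ C, ∀ μ, ‖f μ‖ ≤ C := by
  induction hf using Submodule.span_induction with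
  | mem f hf => obtain ⟨h, hh, rfl⟩ := hf; exact ⟨1, norm_expFun_le h⟩
  | zero => exact ⟨0, fun _ => by simp⟩
  | add a b _ _ ha hb =>
    obtain ⟨A, hA⟩ := ha
    obtain ⟨B, hB⟩ := hb
    exact ⟨A + B, fun μ => (norm_add_le _ _).trans (add_le_add (hA μ) (hB μ))⟩
  | smul c a _ ha =>
    obtain ⟨A, hA⟩ := ha
    refine ⟨‖c‖ * A, fun μ => ?_⟩
    rw [Pi.smul_apply, norm_smul]
    exact mul_le_mul_of_nonneg_left (hA μ) (norm_nonneg _)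

theorem memLp_of_mem_expSpan {Λ : Measure X} {f : PointMeasure X → ℝ}
    (hf : f ∈ expSpan Λ) {P : Measure Ω} [IsFiniteMeasure P] {η : Ω → PointMeasure X}
    (hη : Measurable η) (p : ℝ≥0∞) : MemLp (fun ω => f (η ω)) p P := by
  obtain ⟨C, hC⟩ := exists_bound_of_mem_expSpan hf
  exact MemLp.of_bound ((measurable_of_mem_expSpan hf).comp hη).aestronglyMeasurable C
    (ae_of_all _ fun ω => hC _)

theorem integrable_of_mem_expSpan {Λ : Measure X} {f : PointMeasure X → ℝ}
    (hf : f ∈ expSpan Λ) {P : Measure Ω} [IsFiniteMeasure P] {η : Ω → PointMeasure X}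
    (hη : Measurable η) : Integrable (fun ω => f (η ω)) P :=
  memLp_one_iff_integrable.1 (memLp_of_mem_expSpan hf hη 1)

namespace IsThinningFamily

variable {P : Measure Ω} [IsProbabilityMeasure P] {Λ : Measure X} {η : Ω → PointMeasure X}
  {ζ : ℝ → Ω → PointMeasure X} (hT : IsThinningFamily P Λ η ζ)

include hT

theorem integrable_diffOp_of_mem_expSpan {f : PointMeasure X → ℝ} (hf : f ∈ expSpan Λ)
    (p : (ℝ × X) × Ω) :
    Integrable (fun ω' => diffOp p.1.2 f (ζ p.1.1 p.2 + ζ (1 - p.1.1) ω')) P := by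
  have h1 := hT.measurable_thin (1 - p.1.1)
  exact (integrable_of_mem_expSpan hf (by fun_prop)).sub (integrable_of_mem_expSpan hf (by fun_prop))

theorem clark_add {f g : PointMeasure X → ℝ} (hf : f ∈ expSpan Λ) (hg : g ∈ expSpan Λ) :
    clark P ζ (f + g) = clark P ζ f + clark P ζ g := by
  ext p
  rw [Pi.add_apply, clark, clark, clark, ← integral_add (hT.integrable_diffOp_of_mem_expSpan hf p)
    (hT.integrable_diffOp_of_mem_expSpan hg p)]
  refine integral_congr_ae (ae_of_all _ fun ω => ?_)
  simp only [diffOp, Pi.add_apply]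
  ring

omit [IsProbabilityMeasure P] hT in
theorem clark_smul (c : ℝ) (f : PointMeasure X → ℝ) :
    clark P ζ (c • f) = c • clark P ζ f := by
  ext p
  rw [Pi.smul_apply, clark, clark, ← integral_smul]
  refine integral_congr_ae (ae_of_all _ fun ω => ?_)
  simp only [diffOp, Pi.smul_apply, smul_eq_mul]
  ring

/-- Exponential functionals are multiplicative, so `D_x` becomes the factor `e^{-h(x)} - 1` and the
independent copy integrates out to its Laplace functional. -/
theorem clark_expFun {t : ℝ} (ht : t ∈ Set.Ioc (0 : ℝ) 1) {h : X → ℝ≥0∞} (hh : IsLap Λ h)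
    (x : X) (ω : Ω) :
    clark P ζ (expFun h) ((t, x), ω) =
      (eneg (h x) - 1) * Real.exp (-((1 - t) * (lapExp Λ h).toReal)) * expFun h (ζ t ω) := by
  have ht' : 1 - t ∈ Set.Icc (0 : ℝ) 1 := ⟨by linarith [ht.2], by linarith [ht.1]⟩
  have h1 : ∀ ω', diffOp x (expFun h) (ζ t ω + ζ (1 - t) ω') =
      ((eneg (h x) - 1) * expFun h (ζ t ω)) * expFun h (ζ (1 - t) ω') := by
    intro ω'
    rw [diffOp, expFun_add, expFun_add, expFun_dirac hh.meas]
    ring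
  simp only [clark, h1]
  rw [integral_const_mul, hT.integral_expFun_thin ht' hh.meas, eneg_of_ne_top
    (ENNReal.mul_ne_top ENNReal.ofReal_ne_top hh.ne_top), ENNReal.toReal_mul,
    ENNReal.toReal_ofReal ht'.1]
  ring

omit [MeasurableSpace Ω] [IsProbabilityMeasure P] hT in
theorem _root_.PointMeasure.IsLap.integrable {h : X → ℝ≥0∞} (hh : IsLap Λ h) :
    Integrable (fun x => 1 - eneg (h x)) Λ := by
  have := hh.meas
  refine ⟨by fun_prop, ?_⟩
  rw [hasFiniteIntegral_iff_ofReal (ae_of_all _ fun x => by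
    change 0 ≤ 1 - eneg (h x); linarith [eneg_le_one (h x)])]
  exact hh.ne_top.lt_top

omit [MeasurableSpace Ω] [IsProbabilityMeasure P] hT in
theorem _root_.PointMeasure.IsLap.integral_eq {h : X → ℝ≥0∞} (hh : IsLap Λ h) :
    ∫ x, (1 - eneg (h x)) ∂Λ = (lapExp Λ h).toReal := by
  rw [integral_eq_lintegral_of_nonneg_ae (ae_of_all _ fun x => by
    change 0 ≤ 1 - eneg (h x); linarith [eneg_le_one (h x)]) hh.integrable.1]
  rfl

omit hT in
theorem measurePreserving_space [SigmaFinite Λ] :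
    MeasurePreserving (fun p : (ℝ × X) × Ω => p.1.2) (clarkMeasure P Λ) Λ := by
  have : IsProbabilityMeasure (volume.restrict (Set.Ioc (0 : ℝ) 1)) := ⟨by simp⟩
  exact (measurePreserving_snd (μ := volume.restrict (Set.Ioc (0 : ℝ) 1)) (ν := Λ)).comp
    measurePreserving_fst

omit [IsProbabilityMeasure P] hT in
theorem ae_time_mem [SFinite P] [SFinite Λ] :
    ∀ᵐ p ∂(clarkMeasure P Λ), p.1.1 ∈ Set.Ioc (0 : ℝ) 1 := by
  have h1 : Measure.QuasiMeasurePreserving (fun p : (ℝ × X) × Ω => p.1.1) (clarkMeasure P Λ)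
      (volume.restrict (Set.Ioc (0 : ℝ) 1)) :=
    Measure.quasiMeasurePreserving_fst.comp Measure.quasiMeasurePreserving_fst
  exact h1.ae (ae_restrict_mem measurableSet_Ioc)

theorem memLp_clark_expFun [SigmaFinite Λ] {h : X → ℝ≥0∞} (hh : IsLap Λ h) :
    MemLp (clark P ζ (expFun h)) 2 (clarkMeasure P Λ) := by
  have h1 : MemLp (fun x => 1 - eneg (h x)) 2 Λ := by
    -- A `[0, 1]`-valued integrable function dominates its own square.
    refine (memLp_two_iff_integrable_sq hh.integrable.1).2 ?_
    refine hh.integrable.mono (hh.integrable.1.pow 2) (ae_of_all _ fun x => ?_)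
    have h0 := eneg_mem_Icc (h x)
    rw [Real.norm_of_nonneg (sq_nonneg _), Real.norm_of_nonneg (by linarith [h0.2])]
    nlinarith [h0.1, h0.2]
  have h2 := h1.comp_measurePreserving (measurePreserving_space (P := P) (Λ := Λ))
  refine h2.mono (hT.stronglyMeasurable_clark (measurable_expFun hh.meas)).aestronglyMeasurable ?_
  filter_upwards [ae_time_mem (P := P) (Λ := Λ)] with p hp
  obtain ⟨⟨t, x⟩, ω⟩ := p
  rw [hT.clark_expFun hp hh, norm_mul, norm_mul]
  have e1 : ‖eneg (h x) - 1‖ = ‖1 - eneg (h x)‖ := norm_sub_rev _ _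
  have e2 : ‖Real.exp (-((1 - t) * (lapExp Λ h).toReal))‖ ≤ 1 := by
    rw [Real.norm_of_nonneg (Real.exp_pos _).le]
    refine Real.exp_le_one_iff.2 (neg_nonpos.2 (mul_nonneg ?_ ENNReal.toReal_nonneg))
    linarith [hp.2]
  calc _ ≤ ‖1 - eneg (h x)‖ * 1 * 1 := by
        rw [e1]
        gcongr
        exact norm_expFun_le _ _
    _ = _ := by simp

/-- With `a, b, c` the Laplace exponents of `h, k, h + k`, the `Λ`-integral of `(e^{-h} - 1)(e^{-k}
- 1)` is `a + b - c`, and integrating over `ω` leaves `exp (-(a+b) + t(a+b-c))`. Their product is an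
exact `t`-derivative; its integral over `[0, 1]` is `e^{-c} - e^{-a-b}`, the covariance. -/
theorem integral_clark_mul_expFun [SigmaFinite Λ] {h k : X → ℝ≥0∞} (hh : IsLap Λ h)
    (hk : IsLap Λ k) :
    ∫ p, clark P ζ (expFun h) p * clark P ζ (expFun k) p ∂(clarkMeasure P Λ) =
      ∫ ω, expFun h (η ω) * expFun k (η ω) ∂P -
        (∫ ω, expFun h (η ω) ∂P) * ∫ ω, expFun k (η ω) ∂P := by
  set a := (lapExp Λ h).toReal with ha
  set b := (lapExp Λ k).toReal with hb
  set c := (lapExp Λ (h + k)).toReal with hc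
  have hhk := hh.add hk
  have hP := hT.isPoissonProcess_base
  have hI : Integrable (fun p => clark P ζ (expFun h) p * clark P ζ (expFun k) p)
      (clarkMeasure P Λ) := (hT.memLp_clark_expFun hh).integrable_mul (hT.memLp_clark_expFun hk)
  have hA : ∫ x, (eneg (h x) - 1) * (eneg (k x) - 1) ∂Λ = a + b - c := by
    rw [ha, hb, hc, ← hh.integral_eq, ← hk.integral_eq, ← hhk.integral_eq,
      ← integral_add hh.integrable hk.integrable,
      ← integral_sub (f := fun x => 1 - eneg (h x) + (1 - eneg (k x)))
        (hh.integrable.add hk.integrable) hhk.integrable]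
    refine integral_congr_ae (ae_of_all _ fun x => ?_)
    simp only [Pi.add_apply, eneg_add]
    ring
  have e1 : ∫ p, clark P ζ (expFun h) p * clark P ζ (expFun k) p ∂(clarkMeasure P Λ) =
      ∫ q : ℝ × X, Real.exp (-(a + b) + q.1 * (a + b - c)) *
        ((eneg (h q.2) - 1) * (eneg (k q.2) - 1))
        ∂((volume.restrict (Set.Ioc (0 : ℝ) 1)).prod Λ) := by
    rw [clarkMeasure] at hI ⊢
    rw [integral_prod _ hI]
    have h1 : ∀ᵐ q : ℝ × X ∂((volume.restrict (Set.Ioc (0 : ℝ) 1)).prod Λ),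
        q.1 ∈ Set.Ioc (0 : ℝ) 1 :=
      Measure.quasiMeasurePreserving_fst.ae (ae_restrict_mem measurableSet_Ioc)
    refine integral_congr_ae ?_
    filter_upwards [h1] with q hq
    obtain ⟨t, x⟩ := q
    simp only [hT.clark_expFun hq hh, hT.clark_expFun hq hk]
    have h2 : ∀ ω, (eneg (h x) - 1) * Real.exp (-((1 - t) * a)) * expFun h (ζ t ω) *
        ((eneg (k x) - 1) * Real.exp (-((1 - t) * b)) * expFun k (ζ t ω)) =
        ((eneg (h x) - 1) * (eneg (k x) - 1)) *
          (Real.exp (-((1 - t) * a)) * Real.exp (-((1 - t) * b))) * expFun (h + k) (ζ t ω) := by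
      intro ω
      rw [expFun_fun_add hh.meas]; ring
    simp only [← ha, ← hb, h2]
    rw [integral_const_mul, hT.integral_expFun_thin ⟨hq.1.le, hq.2⟩ hhk.meas, eneg_of_ne_top
      (ENNReal.mul_ne_top ENNReal.ofReal_ne_top hhk.ne_top), ENNReal.toReal_mul,
      ENNReal.toReal_ofReal hq.1.le, ← hc, mul_assoc, ← Real.exp_add, ← Real.exp_add, mul_comm]
    congr 2
    ring
  rw [e1, integral_prod_mul (fun t : ℝ => Real.exp (-(a + b) + t * (a + b - c)))
    (fun x => (eneg (h x) - 1) * (eneg (k x) - 1)), hA, ← integral_mul_const,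
    ← intervalIntegral.integral_of_le zero_le_one]
  have hd : ∀ t : ℝ, HasDerivAt (fun t : ℝ => Real.exp (-(a + b) + t * (a + b - c)))
      (Real.exp (-(a + b) + t * (a + b - c)) * (a + b - c)) t := by
    intro t
    have := (((hasDerivAt_id t).mul_const (a + b - c)).const_add (-(a + b))).exp
    simpa using this
  rw [intervalIntegral.integral_eq_sub_of_hasDerivAt (fun t _ => hd t)
    (Continuous.intervalIntegrable (by fun_prop) _ _)]
  simp only [← expFun_fun_add hh.meas]
  rw [hP.integral_expFun hhk.meas, hP.integral_expFun hh.meas, hP.integral_expFun hk.meas,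
    eneg_of_ne_top hhk.ne_top, eneg_of_ne_top hh.ne_top, eneg_of_ne_top hk.ne_top, ← Real.exp_add,
    ← ha, ← hb, ← hc]
  congr 2 <;> ring

theorem memLp_clark_of_mem_expSpan [SigmaFinite Λ] {f : PointMeasure X → ℝ}
    (hf : f ∈ expSpan Λ) : MemLp (clark P ζ f) 2 (clarkMeasure P Λ) := by
  induction hf using Submodule.span_induction with
  | mem f hf => obtain ⟨h, hh, rfl⟩ := hf; exact hT.memLp_clark_expFun hh
  | zero =>
    have : clark P ζ (0 : PointMeasure X → ℝ) = 0 := by ext p; simp [clark, diffOp]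
    rw [this]; exact MemLp.zero
  | add a b ha hb h1 h2 => rw [hT.clark_add ha hb]; exact h1.add h2
  | smul c a _ h1 => rw [clark_smul]; exact h1.const_smul c

theorem integral_clark_mul_of_mem_expSpan [SigmaFinite Λ] {f g : PointMeasure X → ℝ}
    (hf : f ∈ expSpan Λ) (hg : g ∈ expSpan Λ) :
    ∫ p, clark P ζ f p * clark P ζ g p ∂(clarkMeasure P Λ) =
      ∫ ω, f (η ω) * g (η ω) ∂P - (∫ ω, f (η ω) ∂P) * ∫ ω, g (η ω) ∂P := by
  have z : clark P ζ (0 : PointMeasure X → ℝ) = 0 := by ext p; simp [clark, diffOp]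
  have mη := hT.meas_base
  have hint : ∀ {a b : PointMeasure X → ℝ}, a ∈ expSpan Λ → b ∈ expSpan Λ →
      Integrable (fun ω => a (η ω) * b (η ω)) P := fun ha hb =>
    (memLp_of_mem_expSpan ha mη 2).integrable_mul (memLp_of_mem_expSpan hb mη 2)
  have hint' : ∀ {a b : PointMeasure X → ℝ}, a ∈ expSpan Λ → b ∈ expSpan Λ →
      Integrable (fun p => clark P ζ a p * clark P ζ b p) (clarkMeasure P Λ) := fun ha hb =>
    (hT.memLp_clark_of_mem_expSpan ha).integrable_mul (hT.memLp_clark_of_mem_expSpan hb)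
  induction hg using Submodule.span_induction with
  | mem g hg =>
    have hgs : g ∈ expSpan Λ := Submodule.subset_span hg
    obtain ⟨k, hk, rfl⟩ := hg
    induction hf using Submodule.span_induction with
    | mem f hf =>
      obtain ⟨h, hh, rfl⟩ := hf
      exact hT.integral_clark_mul_expFun hh hk
    | zero => simp [z]
    | add a b ha hb h1 h2 =>
      rw [hT.clark_add ha hb]
      simp only [Pi.add_apply, add_mul]
      rw [integral_add (hint' ha hgs) (hint' hb hgs), integral_add (hint ha hgs) (hint hb hgs),
        integral_add (integrable_of_mem_expSpan ha mη) (integrable_of_mem_expSpan hb mη), h1, h2]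
      ring
    | smul c a ha h1 =>
      rw [clark_smul]
      simp only [Pi.smul_apply, smul_eq_mul, mul_assoc]
      rw [integral_const_mul, integral_const_mul, integral_const_mul, h1]
      ring
  | zero => simp [z]
  | add a b ha hb h1 h2 =>
    rw [hT.clark_add ha hb]
    simp only [Pi.add_apply, mul_add]
    rw [integral_add (hint' hf ha) (hint' hf hb), integral_add (hint hf ha) (hint hf hb),
      integral_add (integrable_of_mem_expSpan ha mη) (integrable_of_mem_expSpan hb mη), h1, h2]
    ring
  | smul c a ha h1 =>
    rw [clark_smul]
    simp only [Pi.smul_apply, smul_eq_mul, mul_left_comm _ c]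
    rw [integral_const_mul, integral_const_mul, integral_const_mul, h1]
    ring

/-- The squared norm on the left is a variance, hence at most the second moment. -/
theorem eLpNorm_clark_le_of_mem_expSpan [SigmaFinite Λ] {f : PointMeasure X → ℝ}
    (hf : f ∈ expSpan Λ) :
    eLpNorm (clark P ζ f) 2 (clarkMeasure P Λ) ≤ eLpNorm (fun ω => f (η ω)) 2 P := by
  refine eLpNorm_two_le_of_integral_le (hT.memLp_clark_of_mem_expSpan hf)
    (memLp_of_mem_expSpan hf hT.meas_base 2) ?_
  rw [hT.integral_clark_mul_of_mem_expSpan hf hf]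
  nlinarith [mul_self_nonneg (∫ ω, f (η ω) ∂P)]

end IsThinningFamily

end PointMeasure

/-! ### Density of exponential functionals and extension to `L²`. -/

namespace PointMeasure

variable {X Ω : Type*} [MeasurableSpace X] [MeasurableSpace Ω]

theorem integral_expFun_withDensity {Q : Measure (PointMeasure X)}
    {φ : PointMeasure X → ℝ} (hφ : AEMeasurable φ Q) {h : X → ℝ≥0∞} :
    ∫ μ, expFun h μ ∂(Q.withDensity fun μ => ENNReal.ofReal (φ μ)) =
      ∫ μ, max (φ μ) 0 * expFun h μ ∂Q := by
  rw [integral_withDensity_eq_integral_toReal_smul₀ hφ.ennreal_ofReal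
    (ae_of_all _ fun _ => ENNReal.ofReal_lt_top)]
  simp only [ENNReal.toReal_ofReal', smul_eq_mul]

/-- An integrable function orthogonal to all exponential functionals vanishes. -/
theorem ae_eq_zero_of_integral_expFun {Λ : Measure X} [SigmaFinite Λ]
    {Q : Measure (PointMeasure X)} [IsFiniteMeasure Q] {φ : PointMeasure X → ℝ}
    (hφ : Integrable φ Q) (H : ∀ h, IsLap Λ h → ∫ μ, expFun h μ * φ μ ∂Q = 0) :
    φ =ᵐ[Q] 0 := by
  have hφn : Integrable (fun μ => -φ μ) Q := hφ.neg
  have f1 : IsFiniteMeasure (Q.withDensity fun μ => ENNReal.ofReal (φ μ)) :=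
    isFiniteMeasure_withDensity_ofReal hφ.2
  have f2 : IsFiniteMeasure (Q.withDensity fun μ => ENNReal.ofReal (-φ μ)) :=
    isFiniteMeasure_withDensity_ofReal hφn.2
  -- Orthogonality says that the positive and negative parts of `φ`, taken as densities, have the
  -- same Laplace functional.
  have key : (Q.withDensity fun μ => ENNReal.ofReal (φ μ)) =
      Q.withDensity fun μ => ENNReal.ofReal (-φ μ) := by
    refine ext_of_expFun Λ fun h hh => ?_
    have hb : ∀ {ψ : PointMeasure X → ℝ}, Integrable ψ Q →
        Integrable (fun μ => max (ψ μ) 0 * expFun h μ) Q := fun hψ =>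
      hψ.pos_part.mul_bdd (c := 1) (measurable_expFun hh.meas).aestronglyMeasurable
        (ae_of_all _ fun μ => norm_expFun_le _ _)
    rw [integral_expFun_withDensity hφ.aemeasurable, integral_expFun_withDensity hφn.aemeasurable,
      ← sub_eq_zero, ← integral_sub (hb hφ) (hb hφn)]
    refine Eq.trans ?_ (H h hh)
    refine integral_congr_ae (ae_of_all _ fun μ => ?_)
    simp only
    rcases le_total 0 (φ μ) with h0 | h0
    · rw [max_eq_left h0, max_eq_right (by linarith)]; ring
    · rw [max_eq_right h0, max_eq_left (by linarith)]; ring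
  have hlt : ∫⁻ μ, ENNReal.ofReal (φ μ) ∂Q ≠ ∞ := by
    have := hφ.pos_part.lintegral_lt_top.ne
    simpa using this
  rw [withDensity_eq_iff hφ.aemeasurable.ennreal_ofReal hφn.aemeasurable.ennreal_ofReal hlt] at key
  filter_upwards [key] with μ hμ
  rcases le_total 0 (φ μ) with h0 | h0
  · rw [ENNReal.ofReal_of_nonpos (p := -φ μ) (by linarith), ENNReal.ofReal_eq_zero] at hμ
    exact le_antisymm hμ h0
  · rw [ENNReal.ofReal_of_nonpos h0, eq_comm, ENNReal.ofReal_eq_zero] at hμ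
    exact le_antisymm h0 (neg_nonpos.1 hμ)

/-- The span of the exponential functionals is dense in `L²(Q)`. -/
theorem exists_expSpan_eLpNorm_lt (Λ : Measure X) [SigmaFinite Λ]
    {Q : Measure (PointMeasure X)} [IsFiniteMeasure Q] {f : PointMeasure X → ℝ}
    (hf : MemLp f 2 Q) {ε : ℝ≥0∞} (hε : ε ≠ 0) :
    ∃ g ∈ expSpan Λ, eLpNorm (g - f) 2 Q < ε := by
  let K : Submodule ℝ (Lp ℝ 2 Q) :=
    { carrier := {φ | ∃ g ∈ expSpan Λ, φ =ᵐ[Q] g}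
      zero_mem' := ⟨0, Submodule.zero_mem _, Lp.coeFn_zero ℝ 2 Q⟩
      add_mem' := by
        rintro a b ⟨g, hg, hag⟩ ⟨g', hg', hbg⟩
        exact ⟨g + g', Submodule.add_mem _ hg hg', (Lp.coeFn_add a b).trans (hag.add hbg)⟩
      smul_mem' := by
        rintro c a ⟨g, hg, hag⟩
        exact ⟨c • g, Submodule.smul_mem _ c hg, (Lp.coeFn_smul c a).trans (hag.const_smul c)⟩ }
  have hK : K.topologicalClosure = ⊤ := by
    rw [Submodule.topologicalClosure_eq_top_iff, Submodule.eq_bot_iff]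
    intro φ hφ
    rw [Lp.eq_zero_iff_ae_eq_zero]
    refine ae_eq_zero_of_integral_expFun (Λ := Λ) ((Lp.memLp φ).integrable (by norm_num))
      fun h hh => ?_
    have hm : MemLp (expFun h) 2 Q := memLp_of_mem_expSpan (expFun_mem_expSpan hh) measurable_id 2
    have := hφ (hm.toLp _) ⟨expFun h, expFun_mem_expSpan hh, hm.coeFn_toLp⟩
    rw [L2.inner_def] at this
    rw [← this]
    refine integral_congr_ae ?_
    filter_upwards [hm.coeFn_toLp] with μ hμ
    rw [hμ]
    simp [mul_comm]
  have hmem : hf.toLp f ∈ closure (K : Set (Lp ℝ 2 Q)) := by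
    rw [← Submodule.topologicalClosure_coe, hK]
    exact Submodule.mem_top
  obtain ⟨ψ, ⟨g, hg, hψg⟩, hψ⟩ := Metric.mem_closure_iff.1 hmem
    -- The minimum keeps the radius finite when `ε = ∞`.
    (min ε 1).toReal (ENNReal.toReal_pos (by simp [hε]) (by simp))
  refine ⟨g, hg, ?_⟩
  have h1 : eLpNorm (g - f) 2 Q = edist ψ (hf.toLp f) := by
    rw [Lp.edist_def]
    exact eLpNorm_congr_ae ((hψg.sub hf.coeFn_toLp).symm)
  rw [h1, edist_dist, dist_comm]
  calc ENNReal.ofReal (dist (hf.toLp f) ψ) < ENNReal.ofReal ((min ε 1).toReal) :=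
        (ENNReal.ofReal_lt_ofReal_iff_of_nonneg dist_nonneg).2 hψ
    _ = min ε 1 := ENNReal.ofReal_toReal (by simp)
    _ ≤ ε := min_le_left _ _

namespace IsThinningFamily

variable {P : Measure Ω} [IsProbabilityMeasure P] {Λ : Measure X} {η : Ω → PointMeasure X}
  {ζ : ℝ → Ω → PointMeasure X} (hT : IsThinningFamily P Λ η ζ)

include hT

theorem exists_seq_expSpan [SigmaFinite Λ] {f : PointMeasure X → ℝ} (hf : Measurable f)
    (hf2 : MemLp (fun ω => f (η ω)) 2 P) {ε : ℕ → ℝ≥0∞} (hε : ∀ n, ε n ≠ 0) :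
    ∃ g : ℕ → PointMeasure X → ℝ, ∀ n, g n ∈ expSpan Λ ∧
      eLpNorm (fun ω => g n (η ω) - f (η ω)) 2 P < ε n := by
  have mη := hT.meas_base
  have hQ : MemLp f 2 (P.map η) :=
    (memLp_map_measure_iff hf.aestronglyMeasurable mη.aemeasurable).2 hf2
  choose g hg hgε using fun n => exists_expSpan_eLpNorm_lt Λ hQ (hε n)
  refine ⟨g, fun n => ⟨hg n, ?_⟩⟩
  have := hgε n
  rwa [eLpNorm_map_measure ((measurable_of_mem_expSpan (hg n)).sub hf).aestronglyMeasurable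
    mη.aemeasurable] at this

/-- Approximation of `f(η) ∈ L²` and of its Clark–Ocone integrand by exponential functionals. -/
theorem exists_approx [SigmaFinite Λ] {f : PointMeasure X → ℝ} (hf : Measurable f)
    (hf2 : MemLp (fun ω => f (η ω)) 2 P) :
    MemLp (clark P ζ f) 2 (clarkMeasure P Λ) ∧ ∃ g : ℕ → PointMeasure X → ℝ,
      (∀ n, g n ∈ expSpan Λ) ∧
      Tendsto (fun n => eLpNorm ((fun ω => g n (η ω)) - fun ω => f (η ω)) 2 P) atTop (𝓝 0) ∧
      Tendsto (fun n => eLpNorm (clark P ζ (g n) - clark P ζ f) 2 (clarkMeasure P Λ))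
        atTop (𝓝 0) := by
  have mη := hT.meas_base
  -- The rate is summable, as the completeness lemma requires; the shift `n + 1` makes two errors
  -- add up to `2^{-N}`.
  obtain ⟨g, hg⟩ := hT.exists_seq_expSpan hf hf2 (ε := fun n => (2⁻¹ : ℝ≥0∞) ^ (n + 1))
    (fun n => by simp)
  have hgs : ∀ n, g n ∈ expSpan Λ := fun n => (hg n).1
  have hgm : ∀ n, Measurable (g n) := fun n => measurable_of_mem_expSpan (hgs n)
  have hg2 : ∀ n, MemLp (fun ω => g n (η ω)) 2 P := fun n => memLp_of_mem_expSpan (hgs n) mη 2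
  have ht0 : Tendsto (fun n : ℕ => (2⁻¹ : ℝ≥0∞) ^ (n + 1)) atTop (𝓝 0) :=
    (ENNReal.tendsto_pow_atTop_nhds_zero_of_lt_one (by norm_num)).comp (tendsto_add_atTop_nat 1)
  have ht1 : Tendsto (fun n => eLpNorm ((fun ω => g n (η ω)) - fun ω => f (η ω)) 2 P) atTop
      (𝓝 0) :=
    tendsto_of_tendsto_of_tendsto_of_le_of_le tendsto_const_nhds ht0 (fun _ => zero_le)
      fun n => (hg n).2.le
  have hcau : ∀ N n m : ℕ, N ≤ n → N ≤ m →
      eLpNorm (clark P ζ (g n) - clark P ζ (g m)) 2 (clarkMeasure P Λ) < (2⁻¹ : ℝ≥0∞) ^ N := by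
    intro N n m hn hm
    rw [← eLpNorm_congr_ae (hT.clark_sub_ae (hgm n) (hg2 n) (hgm m) (hg2 m))]
    refine (hT.eLpNorm_clark_le_of_mem_expSpan (Submodule.sub_mem _ (hgs n) (hgs m))).trans_lt ?_
    have e1 : (fun ω => (g n - g m) (η ω)) =
        (fun ω => g n (η ω) - f (η ω)) - fun ω => g m (η ω) - f (η ω) := by
      ext ω; simp
    rw [e1]
    refine (eLpNorm_sub_le ((hg2 n).1.sub hf2.1) ((hg2 m).1.sub hf2.1) (by norm_num)).trans_lt ?_
    have hle : ∀ k, N ≤ k → (2⁻¹ : ℝ≥0∞) ^ (k + 1) ≤ 2⁻¹ ^ (N + 1) := fun k hk =>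
      pow_le_pow_of_le_one zero_le (by norm_num) (by lia)
    calc _ < (2⁻¹ : ℝ≥0∞) ^ (N + 1) + 2⁻¹ ^ (N + 1) :=
          ENNReal.add_lt_add ((hg n).2.trans_le (hle n hn)) ((hg m).2.trans_le (hle m hm))
      _ = (2⁻¹ : ℝ≥0∞) ^ N := by
          rw [pow_succ, ← mul_add, ENNReal.inv_two_add_inv_two, mul_one]
  obtain ⟨U, hU2, hUt⟩ := Lp.cauchy_complete_eLpNorm (p := 2) (by norm_num)
    (fun n => hT.memLp_clark_of_mem_expSpan (hgs n))
    (B := fun N => (2⁻¹ : ℝ≥0∞) ^ N) (by rw [ENNReal.tsum_geometric]; norm_num) hcau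
  -- On each spanning set the approximants converge in measure to `U` (from `L²`) and to `clark f`
  -- (from the `L¹` bound on `D (g k - f)`), so the two limits agree.
  have hUf : U =ᵐ[clarkMeasure P Λ] clark P ζ f := by
    have h1 : ∀ n, ∀ᵐ p ∂(clarkMeasure P Λ), p ∈ (Set.univ ×ˢ spanningSets Λ n) ×ˢ Set.univ →
        U p = clark P ζ f p := by
      intro n
      have hB := measurableSet_spanningSets Λ n
      obtain ⟨C, hC, hCf⟩ := hT.isPoissonProcess_base.exists_lintegral_diffOp_le hB
        (measure_spanningSets_lt_top Λ n).ne
      have hset : MeasurableSet ((Set.univ ×ˢ spanningSets Λ n) ×ˢ Set.univ :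
          Set ((ℝ × X) × Ω)) := (MeasurableSet.univ.prod hB).prod MeasurableSet.univ
      rw [← ae_restrict_iff' hset]
      refine tendstoInMeasure_ae_unique (f := fun n => clark P ζ (g n)) (u := atTop) ?_ ?_
      · refine tendstoInMeasure_of_tendsto_eLpNorm (p := 2) (by norm_num)
          (fun n => (hT.stronglyMeasurable_clark (hgm n)).aestronglyMeasurable)
          hU2.1.restrict ?_
        exact tendsto_of_tendsto_of_tendsto_of_le_of_le tendsto_const_nhds hUt (fun _ => zero_le)
          fun n => eLpNorm_mono_measure _ Measure.restrict_le_self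
      · refine tendstoInMeasure_of_tendsto_eLpNorm (p := 1) (by norm_num)
          (fun n => (hT.stronglyMeasurable_clark (hgm n)).aestronglyMeasurable)
          (hT.stronglyMeasurable_clark hf).aestronglyMeasurable ?_
        have hlim : Tendsto (fun k => C * eLpNorm ((fun ω => g k (η ω)) - fun ω => f (η ω)) 2 P)
            atTop (𝓝 0) := by
          simpa using ENNReal.Tendsto.const_mul ht1 (Or.inr hC)
        refine tendsto_of_tendsto_of_tendsto_of_le_of_le tendsto_const_nhds hlim
          (fun _ => zero_le) fun k => ?_
        simp only
        rw [← eLpNorm_congr_ae (ae_restrict_of_ae (hT.clark_sub_ae (hgm k) (hg2 k) hf hf2)),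
          eLpNorm_one_eq_lintegral_enorm]
        exact (hT.lintegral_clark_le ((hgm k).sub hf) _).trans (hCf _ ((hgm k).sub hf))
    filter_upwards [ae_all_iff.2 h1] with p hp
    exact hp (spanningSetsIndex Λ p.1.2)
      ⟨⟨Set.mem_univ _, mem_spanningSetsIndex Λ p.1.2⟩, Set.mem_univ _⟩
  refine ⟨(memLp_congr_ae hUf).1 hU2, g, hgs, ht1, hUt.congr fun n => ?_⟩
  exact eLpNorm_congr_ae ((EventuallyEq.refl _ _).sub hUf)

/-- The Clark–Ocone covariance identity. -/
theorem integral_clark_mul [SigmaFinite Λ] {f g : PointMeasure X → ℝ} (hf : Measurable f)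
    (hf2 : MemLp (fun ω => f (η ω)) 2 P) (hg : Measurable g)
    (hg2 : MemLp (fun ω => g (η ω)) 2 P) :
    ∫ p, clark P ζ f p * clark P ζ g p ∂(clarkMeasure P Λ) =
      ∫ ω, f (η ω) * g (η ω) ∂P - (∫ ω, f (η ω) ∂P) * ∫ ω, g (η ω) ∂P := by
  have mη := hT.meas_base
  obtain ⟨hcf, u, hu, hu1, hu2⟩ := hT.exists_approx hf hf2
  obtain ⟨hcg, w, hw, hw1, hw2⟩ := hT.exists_approx hg hg2
  have mu : ∀ n, MemLp (fun ω => u n (η ω)) 2 P := fun n => memLp_of_mem_expSpan (hu n) mη 2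
  have mw : ∀ n, MemLp (fun ω => w n (η ω)) 2 P := fun n => memLp_of_mem_expSpan (hw n) mη 2
  have l1 := tendsto_integral_mul_of_eLpNorm
    (fun n => hT.memLp_clark_of_mem_expSpan (hu n)) (fun n => hT.memLp_clark_of_mem_expSpan (hw n))
    hcf hcg hu2 hw2
  have l2 := tendsto_integral_mul_of_eLpNorm mu mw hf2 hg2 hu1 hw1
  -- Means are inner products with `1`, so the same continuity statement covers them.
  have hone : MemLp (fun _ : Ω => (1 : ℝ)) 2 P := memLp_const 1
  have hone' : Tendsto (fun _ : ℕ => eLpNorm ((fun _ : Ω => (1 : ℝ)) - fun _ => 1) 2 P) atTop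
      (𝓝 0) := by simp
  have l3 := tendsto_integral_mul_of_eLpNorm mu (fun _ => hone) hf2 hone hu1 hone'
  have l4 := tendsto_integral_mul_of_eLpNorm mw (fun _ => hone) hg2 hone hw1 hone'
  simp only [mul_one] at l3 l4
  refine tendsto_nhds_unique l1 ((l2.sub (l3.mul l4)).congr fun n => ?_)
  exact (hT.integral_clark_mul_of_mem_expSpan (hu n) (hw n)).symm

end IsThinningFamily

end PointMeasure

/-! ### Replacing one Clark–Ocone integrand by `D g(η)`. -/

namespace PointMeasure

variable {X Ω : Type*} [MeasurableSpace X] [MeasurableSpace Ω]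

namespace IsThinningFamily

variable {P : Measure Ω} [IsProbabilityMeasure P] {Λ : Measure X} {η : Ω → PointMeasure X}
  {ζ : ℝ → Ω → PointMeasure X} (hT : IsThinningFamily P Λ η ζ)

include hT

theorem integral_pair [SigmaFinite Λ] {t : ℝ} (ht : t ∈ Set.Icc (0 : ℝ) 1)
    {G : PointMeasure X × PointMeasure X → ℝ} (hG : Measurable G)
    (hint : Integrable (fun ω => G (ζ t ω, η ω)) P) :
    ∫ ω, G (ζ t ω, η ω) ∂P = ∫ ω, ∫ ω', G (ζ t ω, ζ t ω + ζ (1 - t) ω') ∂P ∂P := by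
  have m1 := hT.measurable_thin t
  have m2 := hT.measurable_thin (1 - t)
  have m3 := hT.meas_base
  have hmap := hT.map_pair_eq ht
  have ha : AEMeasurable (fun ω => (ζ t ω, η ω)) P := by fun_prop
  have hb : AEMeasurable (fun p : Ω × Ω => (ζ t p.1, ζ t p.1 + ζ (1 - t) p.2)) (P.prod P) := by
    fun_prop
  have hI1 : Integrable G (P.map fun ω => (ζ t ω, η ω)) :=
    (integrable_map_measure hG.aestronglyMeasurable ha).2 hint
  rw [← integral_map ha hG.aestronglyMeasurable, hmap, integral_map hb hG.aestronglyMeasurable]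
  rw [hmap] at hI1
  exact integral_prod _ ((integrable_map_measure hG.aestronglyMeasurable hb).1 hI1)

/-- For fixed `t` and `x`, `D_x g(η)` may be replaced by its conditional expectation given `ζ_t`. -/
theorem integral_clark_mul_diffOp_eq [SigmaFinite Λ] {f g : PointMeasure X → ℝ} (hf : Measurable f)
    (hg : Measurable g) {t : ℝ} (ht : t ∈ Set.Ioc (0 : ℝ) 1) (x : X)
    (hint : Integrable (fun ω => clark P ζ f ((t, x), ω) * diffOp x g (η ω)) P) :
    ∫ ω, clark P ζ f ((t, x), ω) * diffOp x g (η ω) ∂P =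
      ∫ ω, clark P ζ f ((t, x), ω) * clark P ζ g ((t, x), ω) ∂P := by
  have m2 := hT.measurable_thin (1 - t)
  -- `clark f` depends on `ω` only through `ζ_t`; it is a constant factor when the independent copy
  -- is integrated.
  have hΦ : Measurable fun a : PointMeasure X => ∫ ω', diffOp x f (a + ζ (1 - t) ω') ∂P := by
    have : Measurable fun q : PointMeasure X × Ω => diffOp x f (q.1 + ζ (1 - t) q.2) :=
      measurable_diffOp hf measurable_const (by fun_prop)
    exact this.stronglyMeasurable.integral_prod_right'.measurable
  have hD : Measurable fun μ => diffOp x g μ := measurable_diffOp hg measurable_const measurable_id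
  have h1 := hT.integral_pair ⟨ht.1.le, ht.2⟩
    ((hΦ.comp measurable_fst).mul (hD.comp measurable_snd)) hint
  refine h1.trans (integral_congr_ae (ae_of_all _ fun ω => ?_))
  exact integral_const_mul (clark P ζ f ((t, x), ω)) fun ω' =>
    diffOp x g (ζ t ω + ζ (1 - t) ω')

-- Forgetting the time coordinate, which carries a probability measure, transports `D g(η) ∈ L²(P ⊗
-- Λ)` to the space where `clark` lives.
omit hT in
theorem measurePreserving_omega_space [SigmaFinite Λ] :
    MeasurePreserving (fun p : (ℝ × X) × Ω => (p.2, p.1.2)) (clarkMeasure P Λ) (P.prod Λ) := by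
  have : IsProbabilityMeasure (volume.restrict (Set.Ioc (0 : ℝ) 1)) := ⟨by simp⟩
  have h1 : MeasurePreserving (Prod.map (Prod.snd : ℝ × X → X) (id : Ω → Ω)) (clarkMeasure P Λ)
      (Λ.prod P) :=
    (measurePreserving_snd (μ := volume.restrict (Set.Ioc (0 : ℝ) 1)) (ν := Λ)).prod
      (MeasurePreserving.id P)
  exact Measure.measurePreserving_swap.comp h1

theorem integrable_clark_mul_diffOp [SigmaFinite Λ] {f g : PointMeasure X → ℝ} (hf : Measurable f)
    (hf2 : MemLp (fun ω => f (η ω)) 2 P)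
    (hDg : MemLp (fun p : Ω × X => diffOp p.2 g (η p.1)) 2 (P.prod Λ)) :
    Integrable (fun p => clark P ζ f p * diffOp p.1.2 g (η p.2)) (clarkMeasure P Λ) :=
  (hT.exists_approx hf hf2).1.integrable_mul
    (hDg.comp_measurePreserving measurePreserving_omega_space)

/-- The covariance identity with `D g(η)` in `L²`. -/
theorem integral_clark_mul_diffOp [SigmaFinite Λ] {f g : PointMeasure X → ℝ} (hf : Measurable f)
    (hf2 : MemLp (fun ω => f (η ω)) 2 P) (hg : Measurable g)
    (hg2 : MemLp (fun ω => g (η ω)) 2 P)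
    (hDg : MemLp (fun p : Ω × X => diffOp p.2 g (η p.1)) 2 (P.prod Λ)) :
    ∫ p, clark P ζ f p * diffOp p.1.2 g (η p.2) ∂(clarkMeasure P Λ) =
      ∫ ω, f (η ω) * g (η ω) ∂P - (∫ ω, f (η ω) ∂P) * ∫ ω, g (η ω) ∂P := by
  rw [← hT.integral_clark_mul hf hf2 hg hg2]
  have h1 := hT.integrable_clark_mul_diffOp hf hf2 hDg
  have h2 : Integrable (fun p => clark P ζ f p * clark P ζ g p) (clarkMeasure P Λ) :=
    (hT.exists_approx hf hf2).1.integrable_mul (hT.exists_approx hg hg2).1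
  rw [clarkMeasure] at h1 h2 ⊢
  rw [integral_prod _ h1, integral_prod _ h2]
  have h3 : ∀ᵐ q : ℝ × X ∂((volume.restrict (Set.Ioc (0 : ℝ) 1)).prod Λ),
      q.1 ∈ Set.Ioc (0 : ℝ) 1 :=
    Measure.quasiMeasurePreserving_fst.ae (ae_restrict_mem measurableSet_Ioc)
  refine integral_congr_ae ?_
  filter_upwards [h3, h1.prod_right_ae] with q hq hi
  exact hT.integral_clark_mul_diffOp_eq hf hg hq q.2 hi

/-- The covariance identity, with the `Λ`-integral inside the expectation. -/
theorem integral_integral_clark [SigmaFinite Λ] {f g : PointMeasure X → ℝ} (hf : Measurable f)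
    (hf2 : MemLp (fun ω => f (η ω)) 2 P) (hg : Measurable g)
    (hg2 : MemLp (fun ω => g (η ω)) 2 P)
    (hDg : MemLp (fun p : Ω × X => diffOp p.2 g (η p.1)) 2 (P.prod Λ)) :
    Integrable (fun ω => ∫ x, diffOp x g (η ω) *
      (∫ t in (0 : ℝ)..1, clark P ζ f ((t, x), ω)) ∂Λ) P ∧
    ∫ ω, ∫ x, diffOp x g (η ω) * (∫ t in (0 : ℝ)..1, clark P ζ f ((t, x), ω)) ∂Λ ∂P =
      ∫ ω, f (η ω) * g (η ω) ∂P - (∫ ω, f (η ω) ∂P) * ∫ ω, g (η ω) ∂P := by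
  rw [← hT.integral_clark_mul_diffOp hf hf2 hg hg2 hDg]
  have h1 := hT.integrable_clark_mul_diffOp hf hf2 hDg
  rw [clarkMeasure] at h1 ⊢
  -- For almost every `ω`, Fubini in `(t, x)` moves the time integral inside, next to the factor
  -- free of `t`.
  have key : ∀ᵐ ω ∂P, ∫ q : ℝ × X, clark P ζ f (q, ω) * diffOp q.2 g (η ω)
      ∂((volume.restrict (Set.Ioc (0 : ℝ) 1)).prod Λ) =
      ∫ x, diffOp x g (η ω) * (∫ t in (0 : ℝ)..1, clark P ζ f ((t, x), ω)) ∂Λ := by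
    filter_upwards [h1.prod_left_ae] with ω hω
    rw [integral_prod_symm _ hω]
    refine integral_congr_ae (ae_of_all _ fun x => ?_)
    simp only
    rw [integral_mul_const, intervalIntegral.integral_of_le zero_le_one, mul_comm]
  refine ⟨h1.integral_prod_right.congr key, ?_⟩
  rw [integral_prod_symm _ h1]
  exact (integral_congr_ae key).symm

end IsThinningFamily

end PointMeasure

/-! ### The Herbst argument and the Chernoff bound. -/

section Herbst

variable {Ω : Type*} [MeasurableSpace Ω] {P : Measure Ω} [IsProbabilityMeasure P] {F : Ω → ℝ}

theorem integrable_exp_mul_of_Icc {s u : ℝ} (hu : u ∈ Set.Icc 0 s)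
    (hs : Integrable (fun ω => Real.exp (s * F ω)) P) :
    Integrable (fun ω => Real.exp (u * F ω)) P :=
  integrable_exp_mul_of_le_of_le (a := 0) (b := s) (by simp) hs hu.1 hu.2

/-- The point `0` may lie on the boundary of the integrability set, where analyticity of `mgf` gives
nothing; one-sided continuity comes from `e^{uF} ≤ 1 + e^{sF}`. -/
theorem continuousWithinAt_mgf_zero (hF : AEMeasurable F P) {s : ℝ}
    (hs : Integrable (fun ω => Real.exp (s * F ω)) P) :
    ContinuousWithinAt (mgf F P) (Set.Icc 0 s) 0 := by
  refine continuousWithinAt_of_dominated (bound := fun ω => 1 + Real.exp (s * F ω)) ?_ ?_ ?_ ?_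
  · filter_upwards with u
    exact (hF.const_mul u).exp.aestronglyMeasurable
  · filter_upwards [self_mem_nhdsWithin] with u hu
    refine ae_of_all _ fun ω => ?_
    rw [Real.norm_of_nonneg (Real.exp_pos _).le]
    rcases le_total 0 (F ω) with h | h
    · have := Real.exp_le_exp.2 (mul_le_mul_of_nonneg_right hu.2 h)
      linarith
    · have := Real.exp_le_one_iff.2 (mul_nonpos_of_nonneg_of_nonpos hu.1 h)
      linarith [Real.exp_pos (s * F ω)]
  · exact (integrable_const _).add hs
  · exact ae_of_all _ fun ω => by fun_prop

/-- `F` and `e^{uF}` are positively correlated. -/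
theorem cov_exp_nonneg {u : ℝ} (hu : 0 ≤ u) (hF : Integrable F P)
    (hE : Integrable (fun ω => Real.exp (u * F ω)) P)
    (hFE : Integrable (fun ω => F ω * Real.exp (u * F ω)) P) :
    0 ≤ ∫ ω, F ω * Real.exp (u * F ω) ∂P - (∫ ω, F ω ∂P) * ∫ ω, Real.exp (u * F ω) ∂P := by
  set m := ∫ ω, F ω ∂P with hm
  -- Both factors have the same sign, as `y ↦ e^{uy}` is nondecreasing; expanding this product
  -- yields the covariance.
  have h1 : ∀ ω, 0 ≤ (F ω - m) * (Real.exp (u * F ω) - Real.exp (u * m)) := by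
    intro ω
    rcases le_total m (F ω) with h | h
    · exact mul_nonneg (sub_nonneg.2 h)
        (sub_nonneg.2 (Real.exp_le_exp.2 (mul_le_mul_of_nonneg_left h hu)))
    · exact mul_nonneg_of_nonpos_of_nonpos (sub_nonpos.2 h)
        (sub_nonpos.2 (Real.exp_le_exp.2 (mul_le_mul_of_nonneg_left h hu)))
  have h2 : ∀ ω, (F ω - m) * (Real.exp (u * F ω) - Real.exp (u * m)) =
      F ω * Real.exp (u * F ω) - m * Real.exp (u * F ω) - (F ω - m) * Real.exp (u * m) := by
    intro ω; ring
  have h3 : 0 ≤ ∫ ω, (F ω - m) * (Real.exp (u * F ω) - Real.exp (u * m)) ∂P := integral_nonneg h1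
  simp only [h2] at h3
  have i1 : Integrable (fun ω => m * Real.exp (u * F ω)) P := hE.const_mul m
  have i2 : Integrable (fun ω => F ω * Real.exp (u * F ω) - m * Real.exp (u * F ω)) P :=
    hFE.sub i1
  have i3 : Integrable (fun ω => (F ω - m) * Real.exp (u * m)) P :=
    (hF.sub (integrable_const m)).mul_const _
  rw [integral_sub i2 i3, integral_sub hFE i1, integral_const_mul, integral_mul_const,
    integral_sub hF (integrable_const m)] at h3
  simpa [← hm] using h3

/-- The Herbst argument. -/
theorem cgf_sub_le_extIntegral (hF : Integrable F P) {s s' : ℝ} (hs : 0 < s) (hss' : s < s')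
    (hs' : Integrable (fun ω => Real.exp (s' * F ω)) P) {v : ℝ → ℝ}
    (hv : AEMeasurable v (volume.restrict (Set.Ioo 0 s)))
    (hcov : ∀ u ∈ Set.Ioo 0 s,
      ∫ ω, F ω * Real.exp (u * F ω) ∂P - (∫ ω, F ω ∂P) * ∫ ω, Real.exp (u * F ω) ∂P ≤
        v u * ∫ ω, Real.exp (u * F ω) ∂P) :
    ((cgf F P s - s * ∫ ω, F ω ∂P : ℝ) : EReal) ≤ extIntegral v s := by
  set m := ∫ ω, F ω ∂P with hm
  have hint : ∀ u ∈ Set.Icc 0 s', Integrable (fun ω => Real.exp (u * F ω)) P := fun u hu =>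
    integrable_exp_mul_of_Icc hu hs'
  -- The slack `s < s'` puts all of `(0, s]` in the interior, where `mgf` is differentiable.
  have hinter : ∀ u, 0 < u → u < s' → u ∈ interior (integrableExpSet F P) := by
    intro u h0 h1
    exact interior_mono (s := Set.Ioo 0 s') (fun w hw => hint w ⟨hw.1.le, hw.2.le⟩)
      (by rw [interior_Ioo]; exact ⟨h0, h1⟩)
  have hpos : ∀ u ∈ Set.Icc 0 s', 0 < mgf F P u := fun u hu => mgf_pos (hint u hu)
  have hcont : ContinuousOn (fun u => cgf F P u - u * m) (Set.Icc 0 s) := by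
    intro u hu
    refine ContinuousWithinAt.sub (ContinuousWithinAt.log ?_ ?_) (by fun_prop)
    · rcases hu.1.eq_or_lt with h0 | h0
      · rw [← h0]
        exact continuousWithinAt_mgf_zero hF.aemeasurable (hint s ⟨hs.le, hss'.le⟩)
      · exact (differentiableAt_mgf
          (hinter u h0 (hu.2.trans_lt hss'))).continuousAt.continuousWithinAt
    · exact (hpos u ⟨hu.1, hu.2.trans hss'.le⟩).ne'
  have hderiv : ∀ u ∈ Set.Ioo 0 s, HasDerivAt (fun u => cgf F P u - u * m)
      ((∫ ω, F ω * Real.exp (u * F ω) ∂P) / mgf F P u - m) u := by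
    intro u hu
    have h1 := hinter u hu.1 (hu.2.trans hss')
    have h2 := (hasDerivAt_mgf h1).log (hpos u ⟨hu.1.le, (hu.2.trans hss').le⟩).ne'
    have := h2.sub ((hasDerivAt_id u).mul_const m)
    simpa using! this
  have hle : ∀ u ∈ Set.Ioo 0 s, (∫ ω, F ω * Real.exp (u * F ω) ∂P) / mgf F P u - m ≤ v u := by
    intro u hu
    have h1 := hpos u ⟨hu.1.le, (hu.2.trans hss').le⟩
    have h2 := hcov u hu
    rw [sub_le_iff_le_add, div_le_iff₀ h1]
    change _ - m * mgf F P u ≤ v u * mgf F P u at h2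
    linarith
  -- The covariance of `F` and `e^{uF}` is nonnegative, which forces `v ≥ 0`; the negative part in
  -- `extIntegral` vanishes and no `∞ - ∞` arises.
  have hv0 : ∀ u ∈ Set.Ioo 0 s, 0 ≤ v u := by
    intro u hu
    have h1 := hpos u ⟨hu.1.le, (hu.2.trans hss').le⟩
    have hFE : Integrable (fun ω => F ω * Real.exp (u * F ω)) P := by
      simpa using integrable_pow_mul_exp_of_mem_interior_integrableExpSet
        (hinter u hu.1 (hu.2.trans hss')) 1
    have h2 := (cov_exp_nonneg hu.1.le hF (hint u ⟨hu.1.le, (hu.2.trans hss').le⟩) hFE).trans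
      (hcov u hu)
    exact nonneg_of_mul_nonneg_left h2 h1
  have hneg : ∫⁻ u in Set.Ioo 0 s, ENNReal.ofReal (-v u) = 0 := by
    rw [setLIntegral_congr_fun (g := fun _ => 0) measurableSet_Ioo fun u hu =>
      ENNReal.ofReal_of_nonpos (neg_nonpos.2 (hv0 u hu))]
    simp
  rw [extIntegral, hneg]
  by_cases htop : ∫⁻ u in Set.Ioo 0 s, ENNReal.ofReal (v u) = ∞
  · rw [htop]; simp
  have hv0' : 0 ≤ᵐ[volume.restrict (Set.Ioo 0 s)] v := by
    filter_upwards [ae_restrict_mem measurableSet_Ioo] with u hu using hv0 u hu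
  have hvint : IntegrableOn v (Set.Ioo 0 s) :=
    ⟨hv.aestronglyMeasurable, by
      rw [hasFiniteIntegral_iff_ofReal hv0']; exact Ne.lt_top htop⟩
  -- Integrating the derivative bound needs differentiability only inside `(0, s)` and continuity at
  -- the endpoints.
  have h1 := intervalIntegral.sub_le_integral_of_hasDeriv_right_of_le hs.le hcont
    (fun u hu => (hderiv u hu).hasDerivWithinAt)
    ((integrableOn_Icc_iff_integrableOn_Ioo).2 hvint) hle
  rw [intervalIntegral.integral_of_le hs.le, integral_Ioc_eq_integral_Ioo,
    integral_eq_lintegral_of_nonneg_ae hv0' hvint.1] at h1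
  simp only [cgf_zero, zero_mul, sub_zero] at h1
  rw [EReal.coe_ennreal_zero, sub_zero, ← EReal.coe_ennreal_toReal htop]
  exact EReal.coe_le_coe_iff.2 h1

theorem measure_sub_mean_ge_le {s : ℝ} (hs : 0 ≤ s)
    (hint : Integrable (fun ω => Real.exp (s * F ω)) P) (r : ℝ) :
    P {ω | r ≤ F ω - ∫ ω', F ω' ∂P} ≤
      EReal.exp (((cgf F P s - s * ∫ ω, F ω ∂P : ℝ) : EReal) - ((s * r : ℝ) : EReal)) := by
  have h1 := measure_ge_le_exp_cgf (r + ∫ ω, F ω ∂P) hs hint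
  rw [← EReal.coe_sub, EReal.exp_coe]
  have h2 : {ω | r ≤ F ω - ∫ ω', F ω' ∂P} = {ω | r + ∫ ω, F ω ∂P ≤ F ω} := by
    ext ω; simp only [Set.mem_ofPred_eq, le_sub_iff_add_le]
  rw [h2, ← ENNReal.ofReal_toReal (measure_ne_top P _)]
  refine ENNReal.ofReal_le_ofReal (h1.trans (Real.exp_le_exp.2 (le_of_eq ?_)))
  ring

end Herbst

/-! ### Identification of `V_F` and the concentration bound. -/

namespace PointMeasure

variable {X Ω : Type*} [MeasurableSpace X] [MeasurableSpace Ω]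

/-- Two identities: `e^{sf(μ)} (e^{s D_x f(μ)} - 1) = D_x e^{sf}(μ)`, and `Π_{(1-t)Λ}` is the law of
`ζ_{1-t}`. The second family `ζ'` makes room for the unmodified thinning, which agrees with `ζ` only
on a set of full measure. -/
theorem varFunctional_eq {P : Measure Ω} [IsProbabilityMeasure P] {Λ : Measure X} [SigmaFinite Λ]
    {η : Ω → PointMeasure X} {ζ ζ' : ℝ → Ω → PointMeasure X} (hT : IsThinningFamily P Λ η ζ)
    {f : PointMeasure X → ℝ} (hf : Measurable f) (s : ℝ) {ω : Ω} (hω : ∀ t, ζ' t ω = ζ t ω) :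
    Real.exp (s * f (η ω)) * varFunctional η ζ' Λ f s ω =
      ∫ x, diffOp x (fun μ => Real.exp (s * f μ)) (η ω) *
        (∫ t in (0 : ℝ)..1, clark P ζ f ((t, x), ω)) ∂Λ := by
  rw [varFunctional, ← integral_const_mul]
  refine integral_congr_ae (ae_of_all _ fun x => ?_)
  beta_reduce
  have h1 : ∫ t in (0 : ℝ)..1, ∫ μ, diffOp x f (ζ' t ω + μ)
      ∂(poissonLaw (ENNReal.ofReal (1 - t) • Λ)) =
      ∫ t in (0 : ℝ)..1, clark P ζ f ((t, x), ω) := by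
    refine intervalIntegral.integral_congr fun t ht => ?_
    rw [Set.uIcc_of_le zero_le_one] at ht
    have hm : Measurable fun μ => diffOp x f (ζ t ω + μ) :=
      measurable_diffOp hf measurable_const (measurable_const.add measurable_id)
    rw [hω, hT.poissonLaw_eq ⟨sub_nonneg.2 ht.2, sub_le_self 1 ht.1⟩,
      integral_map (hT.measurable_thin _).aemeasurable hm.aestronglyMeasurable]
    rfl
  rw [h1, ← mul_assoc]
  congr 1
  rw [mul_sub, ← Real.exp_add, mul_one, diffOp, diffOp]
  congr 2
  ring

/-- The covariance of `F` and `e^{sF}` is the expectation of `e^{sF} V_F(s)`. -/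
theorem integral_exp_mul_varFunctional {P : Measure Ω} [IsProbabilityMeasure P] {Λ : Measure X}
    [SigmaFinite Λ] {η : Ω → PointMeasure X} (hη : IsPoissonProcess P η Λ)
    {κ : Ω → ℕ∞} {ξ : ℕ → Ω → X} (hκξ : IsProperRepr P η κ ξ)
    {Y : ℝ → ℕ → Ω → Bool} (hY : IsThinningMarks P κ ξ Y)
    {f : PointMeasure X → ℝ} (hf : Measurable f) (hf2 : MemLp (fun ω => f (η ω)) 2 P) {s : ℝ}
    (hs : s ∈ expDomain P η Λ f) :
    Integrable (fun ω => Real.exp (s * f (η ω)) *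
      varFunctional η (thinning κ ξ Y) Λ f s ω) P ∧
    ∫ ω, Real.exp (s * f (η ω)) * varFunctional η (thinning κ ξ Y) Λ f s ω ∂P =
      ∫ ω, f (η ω) * Real.exp (s * f (η ω)) ∂P -
        (∫ ω, f (η ω) ∂P) * ∫ ω, Real.exp (s * f (η ω)) ∂P := by
  obtain ⟨G, hGae, hG, hGr⟩ := hκξ.repr.exists_measurable_mem
  have hT := isThinningFamily_thinOn hη hκξ hY hG hGae hGr
  have hg : Measurable fun μ => Real.exp (s * f μ) := by fun_prop
  obtain ⟨h1, h2⟩ := hT.integral_integral_clark hf hf2 hg hs.2.1 hs.2.2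
  have key : (fun ω => ∫ x, diffOp x (fun μ => Real.exp (s * f μ)) (η ω) *
        (∫ t in (0 : ℝ)..1, clark P (thinOn κ ξ Y G) f ((t, x), ω)) ∂Λ) =ᵐ[P]
      fun ω => Real.exp (s * f (η ω)) * varFunctional η (thinning κ ξ Y) Λ f s ω := by
    filter_upwards [hGae] with ω hω
    exact (varFunctional_eq hT hf s fun t => by simp [thinOn, hω]).symm
  exact ⟨h1.congr key, (integral_congr_ae key).symm.trans h2⟩

end PointMeasure

end

theorem mainTheorem8 {X Ω : Type*} [MeasurableSpace X] [MeasurableSpace Ω]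
    (P : Measure Ω) [IsProbabilityMeasure P] (Λ : Measure X) [SigmaFinite Λ]
    (η : Ω → PointMeasure X) (hη : IsPoissonProcess P η Λ)
    (κ : Ω → ℕ∞) (ξ : ℕ → Ω → X) (hκξ : IsProperRepr P η κ ξ)
    (Y : ℝ → ℕ → Ω → Bool) (hY : IsThinningMarks P κ ξ Y)
    (f : PointMeasure X → ℝ) (hf : Measurable f)
    (F : Ω → ℝ) (hF : F =ᵐ[P] fun ω => f (η ω)) (hF2 : MemLp F 2 P)
    (hdom : ∀ u : ℝ, 0 ≤ u → (u : EReal) < expBound P η Λ f → u ∈ expDomain P η Λ f)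
    (v : ℝ → ℝ)
    (hv : Measurable (Set.domRestrict {s : ℝ | 0 ≤ s ∧ (s : EReal) < expBound P η Λ f} v))
    (hV : ∀ s : ℝ, 0 ≤ s → (s : EReal) < expBound P η Λ f →
      ∀ᵐ ω ∂P, varFunctional η (thinning κ ξ Y) Λ f s ω ≤ v s)
    (r : ℝ) (hr : 0 ≤ r) :
    P {ω | r ≤ F ω - ∫ ω', F ω' ∂P} ≤
      EReal.exp (⨅ s : {s : ℝ // 0 < s ∧ (s : EReal) < expBound P η Λ f},
        (extIntegral v s - ((s * r : ℝ) : EReal))) := by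
  have hf2 : MemLp (fun ω => f (η ω)) 2 P := (memLp_congr_ae hF).1 hF2
  have hFint : Integrable F P := hF2.integrable (by norm_num)
  have hexp : ∀ u : ℝ, (fun ω => Real.exp (u * F ω)) =ᵐ[P] fun ω => Real.exp (u * f (η ω)) := by
    intro u
    filter_upwards [hF] with ω hω
    rw [hω]
  have hexpint : ∀ u ∈ expDomain P η Λ f, Integrable (fun ω => Real.exp (u * F ω)) P := by
    intro u hu
    exact (hu.2.1.integrable (by norm_num)).congr (hexp u).symm
  -- The exponential commutes with the infimum; its value at `⊤` covers the empty index set.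
  rw [EReal.exp_monotone.map_iInf_of_continuousAt ENNReal.continuous_exp.continuousAt EReal.exp_top]
  refine le_iInf fun ⟨s, hs0, hsb⟩ => ?_
  -- Since `s` is below the supremum, some `s' > s` lies in `expDomain`; it provides the slack for
  -- the Herbst argument.
  obtain ⟨s', hs'⟩ := lt_iSup_iff.1 hsb
  obtain ⟨hs'd, hss'⟩ := lt_iSup_iff.1 hs'
  have hss : s < s' := EReal.coe_lt_coe_iff.1 hss'
  have hmem : ∀ u, 0 ≤ u → u < s → (u : EReal) < expBound P η Λ f := fun u _ hu =>
    (EReal.coe_lt_coe_iff.2 hu).trans hsb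
  have hD : MeasurableSet {s : ℝ | 0 ≤ s ∧ (s : EReal) < expBound P η Λ f} :=
    measurableSet_Ici.inter (measurable_coe_real_ereal measurableSet_Iio)
  have hvm : AEMeasurable v (volume.restrict (Set.Ioo 0 s)) := by
    have h1 : AEMeasurable v
        (volume.restrict {s : ℝ | 0 ≤ s ∧ (s : EReal) < expBound P η Λ f}) :=
      (aemeasurable_restrict_iff_comap_subtype hD).2 hv.aemeasurable
    have h2 : Set.Ioo 0 s ⊆ {s : ℝ | 0 ≤ s ∧ (s : EReal) < expBound P η Λ f} := fun u hu =>
      ⟨hu.1.le, hmem u hu.1.le hu.2⟩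
    exact h1.mono_set h2
  refine (measure_sub_mean_ge_le hs0.le (hexpint s (hdom s hs0.le hsb)) r).trans ?_
  refine EReal.exp_monotone (EReal.sub_le_sub ?_ le_rfl)
  refine cgf_sub_le_extIntegral hFint hs0 hss (hexpint s' hs'd) hvm fun u hu => ?_
  have hub := hmem u hu.1.le hu.2
  have hud := hdom u hu.1.le hub
  obtain ⟨h1, h2⟩ := PointMeasure.integral_exp_mul_varFunctional hη hκξ hY hf hf2 hud
  have e1 : ∫ ω, F ω * Real.exp (u * F ω) ∂P = ∫ ω, f (η ω) * Real.exp (u * f (η ω)) ∂P :=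
    integral_congr_ae (hF.mul (hexp u))
  rw [e1, integral_congr_ae hF, integral_congr_ae (hexp u), ← h2, ← integral_const_mul]
  -- The covariance is `E[e^{uF} V_F(u)]`, so the almost sure bound `V_F(u) ≤ v(u)` is integrated
  -- against the weight `e^{uF}`.
  refine integral_mono_ae h1 ((hud.2.1.integrable (by norm_num)).const_mul _) ?_
  filter_upwards [hV u hu.1.le hub] with ω hω
  rw [mul_comm (v u)]
  exact mul_le_mul_of_nonneg_left hω (Real.exp_pos _).le
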